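/- Let $d\in\mathbb N$, $T>0$, let $(\Omega,\mathcal F,\mathbb P)$ be a probability space, and let $H:\mathbb R^d\times\mathbb R^d\times\Omega\to\mathbb R$ satisfy, for some constant $\beta>0$ and all $x,y,p,q\in\mathbb R^d$, $\omega\in\Omega$, (H1) $|H(x,p,\omega)|\le\beta(1+|p|)$; (H2) $|H(x,p,\omega)-H(x,q,\omega)|\le\beta|p-q|$; (H3) $|H(x,p,\omega)-H(y,p,\omega)|\le\beta|x-y|$. For $\varepsilon>0$ consider the equation $$\partial_t u+H\!\left(\tfrac{x}{\varepsilon},D_xu,\omega\right)=0\quad\text{in }(0,T)\times\mathbb R^d .\tag{HJ$_\varepsilon$}$$ Solutions are continuous functions on $[0,T)\times\mathbb R^d$ which solve the equation in the viscosity sense in $(0,T)\times\mathbb R^d$, with test functions in $C^1((0,T)\times\mathbb R^d)$. For $\theta\in\mathbb R^d$, $\varepsilon>0$ and $\omega\in\Omega$, let $\tilde u^\varepsilon_\theta(\cdot,\cdot,\omega)$ denote the solution of (HJ$_\varepsilon$) with $\tilde u^\varepsilon_\theta(0,x,\omega)=\langle\theta,x\rangle$ for all $x\in\mathbb R^d$.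 Assume that there is a function $\overline H:\mathbb R^d\to\mathbb R$ such that, for every $\theta\in\mathbb R^d$ and for every $\omega$ in a set $\Omega_\theta$ of probability $1$, $$\tilde u^\varepsilon_\theta(t,x,\omega)\to\langle\theta,x\rangle-t\overline H(\theta)\quad\text{as }\varepsilon\to0^+,\text{ uniformly on compact subsets of }[0,T)\times\mathbb R^d .$$ Then $\overline H$ satisfies (H1) and (H2) with the same constant, i.e. $|\overline H(p)|\le\beta(1+|p|)$ and $|\overline H(p)-\overline H(q)|\le\beta|p-q|$ for all $p,q\in\mathbb R^d$. Furthermore, there is a set $\hat\Omega$ of probability $1$ such that, for every $\omega\in\hat\Omega$ and every uniformly continuous $g:\mathbb R^d\to\mathbb R$: for every $\varepsilon>0$ there is a unique solution $u^\varepsilon(\cdot,\cdot,\omega)\in C([0,T)\times\mathbb R^d)$ of (HJ$_\varepsilon$) with $u^\varepsilon(0,\cdot,\omega)=g$; there is a unique solution $\overline u\in C([0,T)\times\mathbb R^d)$ of $$\partial_t\overline u+\overline H(D_x\overline u)=0\quad\text{in }(0,T)\times\mathbb R^d,\qquad\overline u(0,\cdot)=g;$$ and $u^\varepsilon(\cdot,\cdot,\omega)\to\overline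 u$ as $\varepsilon\to0^+$, uniformly on compact subsets of $[0,T)\times\mathbb R^d$. -/

import Mathlib

open MeasureTheory Set Filter Topology

noncomputable section

/-- The space `ℝ^d` with its Euclidean norm. -/
abbrev Rd (d : ℕ) : Type := EuclideanSpace ℝ (Fin d)

/-- The half-open strip `[0,T) × ℝ^d`. -/
def strip (d : ℕ) (T : ℝ) : Set (ℝ × Rd d) := Ico 0 T ×ˢ univ

/-- The open strip `(0,T) × ℝ^d`. -/
def openStrip (d : ℕ) (T : ℝ) : Set (ℝ × Rd d) := Ioo 0 T ×ˢ univ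

/-- (H1) for a Hamiltonian `F(x,p)`: `|F(x,p)| ≤ β (1 + |p|)`. -/
def CondH1 {d : ℕ} (β : ℝ) (F : Rd d → Rd d → ℝ) : Prop :=
  ∀ x p, |F x p| ≤ β * (1 + ‖p‖)

/-- (H2) for a Hamiltonian `F(x,p)`: `|F(x,p) - F(x,q)| ≤ β |p - q|`. -/
def CondH2 {d : ℕ} (β : ℝ) (F : Rd d → Rd d → ℝ) : Prop :=
  ∀ x p q, |F x p - F x q| ≤ β * ‖p - q‖

/-- (H3) for a Hamiltonian `F(x,p)`: `|F(x,p) - F(y,p)| ≤ β |x - y|`. -/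
def CondH3 {d : ℕ} (β : ℝ) (F : Rd d → Rd d → ℝ) : Prop :=
  ∀ x y p, |F x p - F y p| ≤ β * ‖x - y‖

/-- The expression `∂_t φ(t,x) + F(x, D_x φ(t,x))` at `z = (t,x)`. -/
def hjOperator {d : ℕ} (F : Rd d → Rd d → ℝ) (φ : ℝ × Rd d → ℝ) (z : ℝ × Rd d) : ℝ :=
  deriv (fun s => φ (s, z.2)) z.1 + F z.2 (gradient (fun y => φ (z.1, y)) z.2)

/-- The subsolution test for `∂_t u + F(x, D_x u) = 0` in `(0,T) × ℝ^d`, with test functions in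
`C¹((0,T) × ℝ^d)`. -/
def SubsolutionTest {d : ℕ} (T : ℝ) (F : Rd d → Rd d → ℝ) (u : ℝ × Rd d → ℝ) : Prop :=
  ∀ φ : ℝ × Rd d → ℝ, ContDiffOn ℝ 1 φ (openStrip d T) →
    ∀ z ∈ openStrip d T, IsLocalMax (fun w => u w - φ w) z → hjOperator F φ z ≤ 0

/-- The supersolution test for `∂_t u + F(x, D_x u) = 0` in `(0,T) × ℝ^d`. -/
def SupersolutionTest {d : ℕ} (T : ℝ) (F : Rd d → Rd d → ℝ) (u : ℝ × Rd d → ℝ) : Prop :=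
  ∀ φ : ℝ × Rd d → ℝ, ContDiffOn ℝ 1 φ (openStrip d T) →
    ∀ z ∈ openStrip d T, IsLocalMin (fun w => u w - φ w) z → 0 ≤ hjOperator F φ z

/-- `u ∈ C([0,T) × ℝ^d)` is a viscosity solution of `∂_t u + F(x, D_x u) = 0` in `(0,T) × ℝ^d`
with `u(0,·) = g`. Only the values of `u` on `[0,T) × ℝ^d` matter. -/
structure IsCauchySolution {d : ℕ} (T : ℝ) (F : Rd d → Rd d → ℝ) (g : Rd d → ℝ)
    (u : ℝ × Rd d → ℝ) : Prop where
  continuousOn : ContinuousOn u (strip d T)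
  sub : SubsolutionTest T F u
  super : SupersolutionTest T F u
  initial : ∀ x, u (0, x) = g x

/-- `u` is the unique viscosity solution in `C([0,T) × ℝ^d)` of the Cauchy problem. -/
def IsUniqueCauchySolution {d : ℕ} (T : ℝ) (F : Rd d → Rd d → ℝ) (g : Rd d → ℝ)
    (u : ℝ × Rd d → ℝ) : Prop :=
  IsCauchySolution T F g u ∧ ∀ v, IsCauchySolution T F g v → EqOn v u (strip d T)

/-- `u^ε → v` as `ε → 0⁺`, uniformly on compact subsets of `[0,T) × ℝ^d`. -/
def ConvergesLocallyUniformly {d : ℕ} (T : ℝ) (u : ℝ → ℝ × Rd d → ℝ) (v : ℝ × Rd d → ℝ) :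
    Prop :=
  ∀ K : Set (ℝ × Rd d), IsCompact K → K ⊆ strip d T → TendstoUniformlyOn u v (𝓝[>] 0) K

/-- The rescaled Hamiltonian `(x,p) ↦ F(x/ε, p)`. -/
def rescale {d : ℕ} (F : Rd d → Rd d → ℝ) (ε : ℝ) : Rd d → Rd d → ℝ :=
  fun x p => F (ε⁻¹ • x) p

end

/-! By (H2) information travels at speed at most `β`: doubling variables with a penalty blowing up
on a truncated cone gives a local comparison principle (`cone_le`), so no growth condition at
infinity is needed.

If a solution `u^ε` lies below an affine function of slope `θ` on a ball at time `s`, comparison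
with the time-shifted solution with data `⟨θ,x⟩` keeps it, in the cone, below an affine function
moving at speed nearly `-Hbar θ`. This is `UpperPropagation` (`upperPropagation_of_linear`). Applied
to `u` and `-u`, it forces the half-relaxed limits to be a sub- and a supersolution of the effective
equation with data `g`; comparison makes them equal, which gives existence and locally uniform
convergence at once (`exists_cauchySolution_of_upperPropagation`).

The same theorem also gives existence for fixed `ε`, the family then being a monotone finite
difference scheme; the constant `C` in `UpperPropagation` accounts for the dependence on `x`, and is
`0` for `Hbar`.

The bounds on `Hbar` come from comparing linear-data solutions with affine perturbations. The
Lipschitz dependence on the slope (`IsCauchySolution.linear_le`) reduces almost sure convergence for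
all `θ` to a countable dense set, so one null set serves every `g`. -/

/-! ### Calculus of partial derivatives for test functions. -/

/-- `φ` has time derivative `a` and spatial gradient `p` at `z`. -/
def HasPartials {d : ℕ} (φ : ℝ × Rd d → ℝ) (a : ℝ) (p : Rd d) (z : ℝ × Rd d) : Prop :=
  HasDerivAt (fun s => φ (s, z.2)) a z.1 ∧
    HasFDerivAt (fun y => φ (z.1, y)) (innerSL ℝ p) z.2

namespace HasPartials

variable {d : ℕ} {φ ψ : ℝ × Rd d → ℝ} {a b : ℝ} {p q : Rd d} {z : ℝ × Rd d}

theorem hjOperator_eq (h : HasPartials φ a p z) (F : Rd d → Rd d → ℝ) :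
    hjOperator F φ z = a + F z.2 p := by
  have : HasGradientAt (fun y => φ (z.1, y)) p z.2 := h.2
  rw [hjOperator, h.1.deriv, this.gradient]

theorem add (h : HasPartials φ a p z) (h' : HasPartials ψ b q z) :
    HasPartials (fun w => φ w + ψ w) (a + b) (p + q) z := by
  refine ⟨h.1.add h'.1, ?_⟩
  rw [map_add]
  exact h.2.add h'.2

theorem neg (h : HasPartials φ a p z) : HasPartials (fun w => -φ w) (-a) (-p) z := by
  refine ⟨h.1.neg, ?_⟩
  rw [map_neg]
  exact h.2.neg

theorem sub (h : HasPartials φ a p z) (h' : HasPartials ψ b q z) :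
    HasPartials (fun w => φ w - ψ w) (a - b) (p - q) z := by
  simpa only [sub_eq_add_neg] using h.add h'.neg

theorem of_hasFDerivAt {L : ℝ × Rd d →L[ℝ] ℝ} (h : HasFDerivAt φ L z) :
    ∃ a p, HasPartials φ a p z ∧ ∀ w, L w = w.1 * a + inner ℝ p w.2 := by
  refine ⟨L (1, 0), (InnerProductSpace.toDual ℝ (Rd d)).symm
    (L.comp (ContinuousLinearMap.inr ℝ ℝ (Rd d))), ⟨?_, ?_⟩, ?_⟩
  · have h1 : HasDerivAt (fun s : ℝ => ((s, z.2) : ℝ × Rd d)) (1, 0) z.1 :=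
      (hasDerivAt_id z.1).prodMk (hasDerivAt_const z.1 z.2)
    exact HasFDerivAt.comp_hasDerivAt (f := fun s : ℝ => ((s, z.2) : ℝ × Rd d)) z.1 h h1
  · have h1 : HasFDerivAt (fun y : Rd d => ((z.1, y) : ℝ × Rd d))
        (ContinuousLinearMap.inr ℝ ℝ (Rd d)) z.2 := hasFDerivAt_prodMk_right z.1 z.2
    have h2 := HasFDerivAt.comp (f := fun y : Rd d => ((z.1, y) : ℝ × Rd d)) z.2 h h1
    refine h2.congr_fderiv ?_
    ext1 y
    simp [← InnerProductSpace.toDual_apply_apply]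
  · intro w
    have hw : w = w.1 • ((1, 0) : ℝ × Rd d) + (0, w.2) := by ext <;> simp
    conv_lhs => rw [hw, map_add, map_smul]
    simp [← InnerProductSpace.toDual_apply_apply]

theorem of_differentiableAt (h : DifferentiableAt ℝ φ z) : ∃ a p, HasPartials φ a p z :=
  let ⟨a, p, h, _⟩ := of_hasFDerivAt h.hasFDerivAt
  ⟨a, p, h⟩

end HasPartials

/-! ### Pointwise viscosity tests, affine functions, and the duality `u ↦ -u`. -/

section Pointwise

variable {d : ℕ}

/-- The subsolution test at a point, for globally `C¹` test functions. -/
def SubsolutionAt (F : Rd d → Rd d → ℝ) (u : ℝ × Rd d → ℝ) (z : ℝ × Rd d) : Prop :=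
  ∀ φ : ℝ × Rd d → ℝ, ContDiff ℝ 1 φ → IsLocalMax (fun w => u w - φ w) z → hjOperator F φ z ≤ 0

/-- The supersolution test at a point, for globally `C¹` test functions. -/
def SupersolutionAt (F : Rd d → Rd d → ℝ) (u : ℝ × Rd d → ℝ) (z : ℝ × Rd d) : Prop :=
  ∀ φ : ℝ × Rd d → ℝ, ContDiff ℝ 1 φ → IsLocalMin (fun w => u w - φ w) z → 0 ≤ hjOperator F φ z

theorem SubsolutionTest.subsolutionAt {T : ℝ} {F : Rd d → Rd d → ℝ} {u : ℝ × Rd d → ℝ}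
    (h : SubsolutionTest T F u) {z : ℝ × Rd d} (hz : z ∈ openStrip d T) : SubsolutionAt F u z :=
  fun φ hφ => h φ hφ.contDiffOn z hz

theorem SupersolutionTest.supersolutionAt {T : ℝ} {F : Rd d → Rd d → ℝ} {u : ℝ × Rd d → ℝ}
    (h : SupersolutionTest T F u) {z : ℝ × Rd d} (hz : z ∈ openStrip d T) :
    SupersolutionAt F u z :=
  fun φ hφ => h φ hφ.contDiffOn z hz

theorem hasPartials_quadratic (n : ℝ) (c z : ℝ × Rd d) :
    HasPartials (fun w : ℝ × Rd d => n / 2 * ((w.1 - c.1) ^ 2 + ‖w.2 - c.2‖ ^ 2))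
      (n * (z.1 - c.1)) (n • (z.2 - c.2)) z := by
  constructor
  · have h := ((((hasDerivAt_id z.1).sub_const c.1).pow 2).add_const
      (‖z.2 - c.2‖ ^ 2)).const_mul (n / 2)
    refine h.congr_deriv ?_
    simp
    ring
  · have h0 : HasFDerivAt (fun y : Rd d => y - c.2) (ContinuousLinearMap.id ℝ (Rd d)) z.2 :=
      (hasFDerivAt_id z.2).sub_const c.2
    have h := ((h0.norm_sq).const_add ((z.1 - c.1) ^ 2)).const_mul (n / 2)
    refine h.congr_fderiv ?_
    ext1 y
    simp
    ring

theorem contDiff_quadratic (n : ℝ) (c : ℝ × Rd d) :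
    ContDiff ℝ 1 (fun w : ℝ × Rd d => n / 2 * ((w.1 - c.1) ^ 2 + ‖w.2 - c.2‖ ^ 2)) := by
  have h : ContDiff ℝ 1 (fun w : ℝ × Rd d => ‖w.2 - c.2‖ ^ 2) :=
    (contDiff_snd.sub contDiff_const).norm_sq ℝ
  fun_prop

theorem hasPartials_affine (θ : Rd d) (a c : ℝ) (z : ℝ × Rd d) :
    HasPartials (fun w : ℝ × Rd d => a + inner ℝ θ w.2 + w.1 * c) c θ z := by
  constructor
  · simpa using ((hasDerivAt_id z.1).mul_const c).const_add (a + inner ℝ θ z.2)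
  · exact (((innerSL ℝ θ).hasFDerivAt (x := z.2)).const_add a).add_const (z.1 * c)

theorem contDiff_affine (θ : Rd d) (a c : ℝ) :
    ContDiff ℝ 1 (fun w : ℝ × Rd d => a + inner ℝ θ w.2 + w.1 * c) := by
  have h : ContDiff ℝ 1 (fun w : ℝ × Rd d => inner ℝ θ w.2) :=
    contDiff_const.inner ℝ contDiff_snd
  fun_prop

/-- Adding an affine function with slope `δ` and speed at least `β ‖δ‖` preserves supersolutions. -/
theorem SupersolutionAt.add_affine {β : ℝ} {F : Rd d → Rd d → ℝ} (hF : CondH2 β F)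
    {v : ℝ × Rd d → ℝ} {z : ℝ × Rd d} (hv : SupersolutionAt F v z) (δ : Rd d) (a : ℝ) {c : ℝ}
    (hc : β * ‖δ‖ ≤ c) :
    SupersolutionAt F (fun w => v w + (a + inner ℝ δ w.2 + w.1 * c)) z := by
  intro φ hφ hmin
  obtain ⟨b, p, hbp⟩ := HasPartials.of_differentiableAt
    ((hφ.differentiable one_ne_zero).differentiableAt (x := z))
  have h := hv (fun w => φ w - (a + inner ℝ δ w.2 + w.1 * c)) (hφ.sub (contDiff_affine δ a c))
    (hmin.congr (Eventually.of_forall fun w => by ring))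
  rw [(hbp.sub (hasPartials_affine δ a c z)).hjOperator_eq] at h
  rw [hbp.hjOperator_eq]
  have h2 := (abs_le.1 (hF z.2 (p - δ) p)).2
  rw [show p - δ - p = -δ by abel, norm_neg] at h2
  linarith

/-- A differentiable function touched from below has the same derivatives as the test function, so
the test reduces to the classical inequality. -/
theorem supersolutionAt_affine {F : Rd d → Rd d → ℝ} {θ : Rd d} {a c : ℝ} {z : ℝ × Rd d}
    (hc : -F z.2 θ ≤ c) : SupersolutionAt F (fun w => a + inner ℝ θ w.2 + w.1 * c) z := by
  intro φ hφ hmin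
  obtain ⟨b, p, hbp⟩ := HasPartials.of_differentiableAt
    ((hφ.differentiable one_ne_zero).differentiableAt (x := z))
  have h := (hasPartials_affine θ a c z).sub hbp
  rw [hbp.hjOperator_eq]
  have h1 : IsLocalMin (fun s => a + inner ℝ θ z.2 + s * c - φ (s, z.2)) z.1 := by
    have : Tendsto (fun s : ℝ => ((s, z.2) : ℝ × Rd d)) (𝓝 z.1) (𝓝 z) :=
      (Continuous.prodMk_left z.2).tendsto' _ _ rfl
    exact this.eventually hmin
  have h2 : IsLocalMin (fun y => a + inner ℝ θ y + z.1 * c - φ (z.1, y)) z.2 := by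
    have : Tendsto (fun y : Rd d => ((z.1, y) : ℝ × Rd d)) (𝓝 z.2) (𝓝 z) :=
      (Continuous.prodMk_right z.1).tendsto' _ _ rfl
    exact this.eventually hmin
  have e1 := h1.hasDerivAt_eq_zero h.1
  have e2 := h2.hasFDerivAt_eq_zero h.2
  have e3 : θ - p = 0 := by
    have := DFunLike.congr_fun e2 (θ - p)
    rwa [innerSL_apply_apply, zero_apply, inner_self_eq_zero] at this
  rw [← sub_eq_zero.1 e3]
  linarith

/-- The Hamiltonian of the equation solved by `-u`. -/
def dualHamiltonian (F : Rd d → Rd d → ℝ) : Rd d → Rd d → ℝ := fun x p => -F x (-p)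

theorem dualHamiltonian_dualHamiltonian (F : Rd d → Rd d → ℝ) :
    dualHamiltonian (dualHamiltonian F) = F := by
  ext x p
  simp [dualHamiltonian]

theorem CondH2.dual {β : ℝ} {F : Rd d → Rd d → ℝ} (h : CondH2 β F) :
    CondH2 β (dualHamiltonian F) := by
  intro x p q
  have := h x (-q) (-p)
  rwa [show -q - -p = p - q by abel, show F x (-q) - F x (-p) = -F x (-p) - -F x (-q) by ring]
    at this

theorem CondH3.dual {β : ℝ} {F : Rd d → Rd d → ℝ} (h : CondH3 β F) :
    CondH3 β (dualHamiltonian F) := by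
  intro x y p
  have := h y x (-p)
  rwa [norm_sub_rev, show F y (-p) - F x (-p) = -F x (-p) - -F y (-p) by ring] at this

theorem hjOperator_neg (F : Rd d → Rd d → ℝ) (φ : ℝ × Rd d → ℝ) (z : ℝ × Rd d) :
    hjOperator (dualHamiltonian F) (fun w => -φ w) z = -hjOperator F φ z := by
  have h : gradient (fun y => -φ (z.1, y)) z.2 = -gradient (fun y => φ (z.1, y)) z.2 := by
    rw [gradient, gradient, fderiv_fun_neg, map_neg]
  simp only [hjOperator, dualHamiltonian, h, deriv.fun_neg, neg_neg]
  ring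

theorem SubsolutionTest.neg {T : ℝ} {F : Rd d → Rd d → ℝ} {u : ℝ × Rd d → ℝ}
    (h : SubsolutionTest T F u) : SupersolutionTest T (dualHamiltonian F) (fun z => -u z) := by
  intro φ hφ z hz hmin
  have h1 := h (fun w => -φ w) hφ.neg z hz
    (hmin.neg.congr (Eventually.of_forall fun w => by ring))
  have h2 := hjOperator_neg (dualHamiltonian F) φ z
  rw [dualHamiltonian_dualHamiltonian] at h2
  linarith

theorem SupersolutionTest.neg {T : ℝ} {F : Rd d → Rd d → ℝ} {u : ℝ × Rd d → ℝ}
    (h : SupersolutionTest T F u) : SubsolutionTest T (dualHamiltonian F) (fun z => -u z) := by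
  intro φ hφ z hz hmax
  have h1 := h (fun w => -φ w) hφ.neg z hz
    (hmax.neg.congr (Eventually.of_forall fun w => by ring))
  have h2 := hjOperator_neg (dualHamiltonian F) φ z
  rw [dualHamiltonian_dualHamiltonian] at h2
  linarith

theorem IsCauchySolution.neg {T : ℝ} {F : Rd d → Rd d → ℝ} {g : Rd d → ℝ} {u : ℝ × Rd d → ℝ}
    (h : IsCauchySolution T F g u) :
    IsCauchySolution T (dualHamiltonian F) (fun x => -g x) (fun z => -u z) :=
  ⟨h.continuousOn.neg, h.super.neg, h.sub.neg, fun x => by rw [h.initial]⟩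

end Pointwise

/-! ### Comparison on truncated cones. -/

theorem HasPartials.comp {d : ℕ} {φ : ℝ × Rd d → ℝ} {a c : ℝ} {p : Rd d} {z : ℝ × Rd d}
    {G : ℝ → ℝ} (hG : HasDerivAt G c (φ z)) (h : HasPartials φ a p z) :
    HasPartials (fun w => G (φ w)) (c * a) (c • p) z := by
  refine ⟨HasDerivAt.comp (h := fun s => φ (s, z.2)) z.1 hG h.1, ?_⟩
  rw [map_smul]
  exact HasDerivAt.comp_hasFDerivAt (f := fun y => φ (z.1, y)) z.2 hG h.2

/-- A smooth step of height `M`, vanishing on `(-∞, a]` and equal to `M` on `[b, ∞)`. -/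
theorem exists_smooth_step {a b M : ℝ} (hab : a < b) (hM : 0 ≤ M) :
    ∃ G : ℝ → ℝ, ContDiff ℝ 1 G ∧ (∀ r, 0 ≤ deriv G r) ∧ (∀ r, 0 ≤ G r) ∧ G a = 0 ∧
      ∀ r, b ≤ r → G r = M := by
  have hpos : 0 < b - a := sub_pos.2 hab
  refine ⟨fun r => M * Real.smoothTransition ((r - a) / (b - a)), ?_, ?_, ?_, ?_, ?_⟩
  · have h : ContDiff ℝ 1 Real.smoothTransition := Real.smoothTransition.contDiff
    have h2 : ContDiff ℝ 1 (fun r : ℝ => (r - a) / (b - a)) := by fun_prop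
    exact contDiff_const.mul (h.comp h2)
  · intro r
    apply Monotone.deriv_nonneg
    intro r r' h
    have : (r - a) / (b - a) ≤ (r' - a) / (b - a) := by gcongr
    exact mul_le_mul_of_nonneg_left (Real.smoothTransition.monotone this) hM
  · exact fun r => mul_nonneg hM (Real.smoothTransition.nonneg _)
  · simp
  · intro r hr
    have : 1 ≤ (r - a) / (b - a) := by rw [le_div_iff₀ hpos]; linarith
    simp [Real.smoothTransition.one_of_one_le this]

/-- The penalty is a nondecreasing step of a smoothed cone function `|x - x₀| + β (t - s)`, plus a
step in time, plus `η (t - s)`. The cone function has time derivative `β` and gradient of norm at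
most `1`, hence `β ‖p‖ + η ≤ a`: adding the penalty keeps a strict margin `η` in the equation. The
steps of height `M` keep maxima away from the lateral boundary and the final time. -/
theorem exists_cone_penalty {d : ℕ} {β s b t₁ R M η : ℝ} {x₀ x₁ : Rd d} (hβ : 0 ≤ β)
    (ht : t₁ < b) (hx : ‖x₁ - x₀‖ + β * (t₁ - s) < R) (hM : 0 ≤ M) (hη : 0 ≤ η) :
    ∃ ψ : ℝ × Rd d → ℝ, ContDiff ℝ 1 ψ ∧ ψ (t₁, x₁) = η * (t₁ - s) ∧
      (∀ z : ℝ × Rd d, s ≤ z.1 → 0 ≤ ψ z) ∧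
      (∀ z : ℝ × Rd d, s ≤ z.1 → b ≤ z.1 → M ≤ ψ z) ∧
      (∀ z : ℝ × Rd d, s ≤ z.1 → R ≤ ‖z.2 - x₀‖ → M ≤ ψ z) ∧
      ∀ z, ∃ a p, HasPartials ψ a p z ∧ β * ‖p‖ + η ≤ a := by
  -- Smoothing the norm at the apex costs at most `κ`, taken as half of the room left below `R`.
  obtain ⟨κ, hκ, hκR⟩ : ∃ κ : ℝ, 0 < κ ∧ √(‖x₁ - x₀‖ ^ 2 + κ ^ 2) + β * (t₁ - s) < R := by
    refine ⟨(R - (‖x₁ - x₀‖ + β * (t₁ - s))) / 2, by linarith, ?_⟩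
    set κ := (R - (‖x₁ - x₀‖ + β * (t₁ - s))) / 2 with hκ
    have h0 : 0 < κ := by rw [hκ]; linarith
    have : √(‖x₁ - x₀‖ ^ 2 + κ ^ 2) ≤ ‖x₁ - x₀‖ + κ := by
      rw [Real.sqrt_le_left (by positivity)]
      nlinarith [norm_nonneg (x₁ - x₀)]
    linarith
  set ρ : ℝ × Rd d → ℝ := fun z => √(‖z.2 - x₀‖ ^ 2 + κ ^ 2) + β * (z.1 - s) with hρ
  have hin : ∀ y : Rd d, 0 < ‖y - x₀‖ ^ 2 + κ ^ 2 := fun y => by positivity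
  have hρc : ContDiff ℝ 1 ρ := by
    have h : ContDiff ℝ 1 (fun w : ℝ × Rd d => ‖w.2 - x₀‖ ^ 2 + κ ^ 2) :=
      ((contDiff_snd.sub contDiff_const).norm_sq ℝ).add contDiff_const
    exact (h.sqrt fun w => (hin w.2).ne').add
      (contDiff_const.mul (contDiff_fst.sub contDiff_const))
  have hρp : ∀ z, HasPartials ρ β ((√(‖z.2 - x₀‖ ^ 2 + κ ^ 2))⁻¹ • (z.2 - x₀)) z := by
    intro z
    constructor
    · have := (((hasDerivAt_id z.1).sub_const s).const_mul β).const_add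
        (√(‖z.2 - x₀‖ ^ 2 + κ ^ 2))
      rwa [mul_one] at this
    · have h0 : HasFDerivAt (fun y : Rd d => y - x₀) (ContinuousLinearMap.id ℝ (Rd d)) z.2 :=
        (hasFDerivAt_id z.2).sub_const x₀
      have h := ((h0.norm_sq.add_const (κ ^ 2)).sqrt (hin z.2).ne').add_const (β * (z.1 - s))
      refine h.congr_fderiv ?_
      ext1 y
      simp
      ring
  have hp : ∀ y : Rd d, ‖(√(‖y - x₀‖ ^ 2 + κ ^ 2))⁻¹ • (y - x₀)‖ ≤ 1 := by
    intro y
    have h1 : 0 < √(‖y - x₀‖ ^ 2 + κ ^ 2) := Real.sqrt_pos.2 (hin y)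
    rw [norm_smul, norm_inv, Real.norm_of_nonneg h1.le, inv_mul_le_iff₀ h1, mul_one]
    exact Real.le_sqrt_of_sq_le (by nlinarith)
  obtain ⟨G, hGc, hG', hG0, hGa, hGb⟩ := exists_smooth_step (M := M) hκR hM
  obtain ⟨J, hJc, hJ', hJ0, hJa, hJb⟩ := exists_smooth_step (M := M) ht hM
  refine ⟨fun z => G (ρ z) + J z.1 + (-(η * s) + inner ℝ (0 : Rd d) z.2 + z.1 * η), ?_, ?_, ?_,
    ?_, ?_, ?_⟩
  · exact ((hGc.comp hρc).add (hJc.comp contDiff_fst)).add (contDiff_affine 0 _ _)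
  · simp only [hρ, hGa, hJa, inner_zero_left]
    ring
  · intro z hz
    have := hG0 (ρ z)
    have := hJ0 z.1
    have := mul_nonneg hη (sub_nonneg.2 hz)
    simp only [inner_zero_left]
    linarith
  · intro z hz hzb
    have := hG0 (ρ z)
    have := hJb z.1 hzb
    have := mul_nonneg hη (sub_nonneg.2 hz)
    simp only [inner_zero_left]
    linarith
  · intro z hz hzR
    have h1 : R ≤ ρ z := by
      have h2 : ‖z.2 - x₀‖ ≤ √(‖z.2 - x₀‖ ^ 2 + κ ^ 2) := Real.le_sqrt_of_sq_le (by nlinarith)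
      have := mul_nonneg hβ (sub_nonneg.2 hz)
      simp only [hρ]
      linarith
    have := hGb _ h1
    have := hJ0 z.1
    have := mul_nonneg hη (sub_nonneg.2 hz)
    simp only [inner_zero_left]
    linarith
  · intro z
    have hJz : HasPartials (fun w : ℝ × Rd d => J w.1) (deriv J z.1) 0 z := by
      refine ⟨((hJc.differentiable one_ne_zero) z.1).hasDerivAt, ?_⟩
      rw [map_zero]
      exact hasFDerivAt_const (J z.1) z.2
    have h1 := (hρp z).comp ((hGc.differentiable one_ne_zero) (ρ z)).hasDerivAt
    refine ⟨_, _, (h1.add hJz).add (hasPartials_affine 0 (-(η * s)) η z), ?_⟩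
    rw [add_zero, add_zero, norm_smul, Real.norm_of_nonneg (hG' _)]
    have h2 := mul_le_mul_of_nonneg_left (hp z.2) (hG' (ρ z))
    have h3 := mul_le_mul_of_nonneg_left h2 hβ
    have := hJ' z.1
    linarith

/-- The core of the doubling of variables: at an interior maximum of the doubled functional, the
two tests give an upper bound for the strictness `η` of the penalty. -/
theorem doubling_estimate {d : ℕ} {β C η n : ℝ} {F : Rd d → Rd d → ℝ} (hF : CondH2 β F)
    (hFx : CondH3 C F) {u v ψ : ℝ × Rd d → ℝ} (hψ : ContDiff ℝ 1 ψ) {z w : ℝ × Rd d}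
    (hψz : ∃ a p, HasPartials ψ a p z ∧ β * ‖p‖ + η ≤ a)
    (hu : SubsolutionAt F u z) (hv : SupersolutionAt F v w)
    (hmax : ∀ᶠ z' in 𝓝 z, ∀ᶠ w' in 𝓝 w,
      u z' - v w' - n / 2 * ((z'.1 - w'.1) ^ 2 + ‖z'.2 - w'.2‖ ^ 2) - ψ z' ≤
        u z - v w - n / 2 * ((z.1 - w.1) ^ 2 + ‖z.2 - w.2‖ ^ 2) - ψ z) :
    η ≤ C * ‖z.2 - w.2‖ := by
  obtain ⟨a, p, hp, hpa⟩ := hψz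
  have h1 := hu (fun z' => n / 2 * ((z'.1 - w.1) ^ 2 + ‖z'.2 - w.2‖ ^ 2) + ψ z')
    ((contDiff_quadratic n w).add hψ) (by
      filter_upwards [hmax] with z' hz'
      have := hz'.self_of_nhds
      linarith)
  have h2 := hv (fun w' => -(n / 2 * ((w'.1 - z.1) ^ 2 + ‖w'.2 - z.2‖ ^ 2)))
    (contDiff_quadratic n z).neg (by
      filter_upwards [hmax.self_of_nhds] with w' hw'
      rw [norm_sub_rev w'.2, norm_sub_rev w.2]
      linarith)
  rw [((hasPartials_quadratic n w z).add hp).hjOperator_eq] at h1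
  rw [(hasPartials_quadratic n z w).neg.hjOperator_eq, ← smul_neg, neg_sub] at h2
  -- Both tests carry the slope `n • (z.2 - w.2)` and the same quadratic time derivative, which
  -- cancels. Since the modulus in `x` does not grow with the slope, only `C * ‖z.2 - w.2‖` remains.
  have h3 := (abs_le.1 (hF z.2 (n • (z.2 - w.2) + p) (n • (z.2 - w.2)))).1
  rw [add_sub_cancel_left] at h3
  have h4 := (abs_le.1 (hFx z.2 w.2 (n • (z.2 - w.2)))).1
  linarith

/-- Comparison with finite speed of propagation, on a truncated cone. -/
theorem cone_le {d : ℕ} {β C s b R : ℝ} {F : Rd d → Rd d → ℝ} {x₀ : Rd d} (hβ : 0 ≤ β)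
    (hF : CondH2 β F) (hFx : CondH3 C F) {u v : ℝ × Rd d → ℝ}
    (hu : UpperSemicontinuousOn u (Icc s b ×ˢ Metric.closedBall x₀ R))
    (hv : UpperSemicontinuousOn (fun z => -v z) (Icc s b ×ˢ Metric.closedBall x₀ R))
    (hsub : ∀ z ∈ Ioo s b ×ˢ Metric.ball x₀ R, SubsolutionAt F u z)
    (hsup : ∀ z ∈ Ioo s b ×ˢ Metric.ball x₀ R, SupersolutionAt F v z)
    (hinit : ∀ y ∈ Metric.closedBall x₀ R, u (s, y) ≤ v (s, y))
    {t₁ : ℝ} {x₁ : Rd d} (ht : t₁ ∈ Ico s b) (hx : ‖x₁ - x₀‖ + β * (t₁ - s) < R) :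
    u (t₁, x₁) ≤ v (t₁, x₁) := by
  by_contra! hlt
  set K : Set (ℝ × Rd d) := Icc s b ×ˢ Metric.closedBall x₀ R with hK
  have hKc : IsCompact K := isCompact_Icc.prod (isCompact_closedBall x₀ R)
  have hz₁ : (t₁, x₁) ∈ K := by
    refine ⟨Ico_subset_Icc_self ht, ?_⟩
    rw [mem_closedBall_iff_norm]
    have := mul_nonneg hβ (sub_nonneg.2 ht.1)
    linarith
  set σ := u (t₁, x₁) - v (t₁, x₁) with hσ
  have hσ0 : 0 < σ := sub_pos.2 hlt
  obtain ⟨m₁, hm₁⟩ := hu.bddAbove_of_isCompact hKc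
  obtain ⟨m₂, hm₂⟩ := hv.bddAbove_of_isCompact hKc
  have hM : ∀ z ∈ K, ∀ w ∈ K, u z - v w ≤ m₁ + m₂ := fun z hz w hw => by
    have h1 := hm₁ (mem_image_of_mem u hz)
    have h2 := hm₂ (mem_image_of_mem (fun z => -v z) hw)
    linarith
  have hM0 : 0 < m₁ + m₂ := hσ0.trans_le (hM _ hz₁ _ hz₁)
  have hsb : 0 < b - s := by linarith [ht.1, ht.2]
  -- With this `η` the penalty at `(t₁, x₁)` is at most `σ / 2`, so half of the gap survives.
  set η := σ / (2 * (b - s)) with hη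
  have hη0 : 0 < η := by positivity
  obtain ⟨ψ, hψc, hψ₁, hψ0, hψb, hψR, hψp⟩ :=
    exists_cone_penalty (M := m₁ + m₂) (s := s) hβ ht.2 hx hM0.le hη0.le
  have hψ₁' : ψ (t₁, x₁) ≤ σ / 2 := by
    rw [hψ₁, show σ / 2 = η * (b - s) by rw [hη]; field_simp]
    have := ht.2
    gcongr
  have husc : UpperSemicontinuousOn (fun q : (ℝ × Rd d) × (ℝ × Rd d) => u q.1 + -v q.2)
      (K ×ˢ K) :=
    UpperSemicontinuousOn.add
      (fun q hq y hy => (continuous_fst.continuousWithinAt.tendsto_nhdsWithin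
        (fun _ h => h.1 : MapsTo Prod.fst (K ×ˢ K) K)).eventually (hu q.1 hq.1 y hy))
      (fun q hq y hy => (continuous_snd.continuousWithinAt.tendsto_nhdsWithin
        (fun _ h => h.2 : MapsTo Prod.snd (K ×ˢ K) K)).eventually (hv q.2 hq.2 y hy))
  have hex : ∀ n : ℕ, ∃ q ∈ K ×ˢ K, ∀ q' ∈ K ×ˢ K,
      u q'.1 - v q'.2 - (n : ℝ) / 2 * ((q'.1.1 - q'.2.1) ^ 2 + ‖q'.1.2 - q'.2.2‖ ^ 2) - ψ q'.1 ≤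
      u q.1 - v q.2 - (n : ℝ) / 2 * ((q.1.1 - q.2.1) ^ 2 + ‖q.1.2 - q.2.2‖ ^ 2) - ψ q.1 := by
    intro n
    have hc : Continuous (fun q : (ℝ × Rd d) × (ℝ × Rd d) =>
        -((n : ℝ) / 2 * ((q.1.1 - q.2.1) ^ 2 + ‖q.1.2 - q.2.2‖ ^ 2)) - ψ q.1) := by
      have := hψc.continuous
      fun_prop
    have hne : (K ×ˢ K).Nonempty := ⟨((t₁, x₁), (t₁, x₁)), hz₁, hz₁⟩
    obtain ⟨q, hq, hqm⟩ := (husc.add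
      (hc.upperSemicontinuous.upperSemicontinuousOn (K ×ˢ K))).exists_isMaxOn hne (hKc.prod hKc)
    refine ⟨q, hq, fun q' hq' => ?_⟩
    have := isMaxOn_iff.1 hqm q' hq'
    linarith
  choose q hqK hqmax using hex
  obtain ⟨⟨z, w⟩, hzw, φ, hφ, hlim⟩ := (hKc.prod hKc).tendsto_subseq hqK
  have hlow : ∀ n : ℕ, σ / 2 + (n : ℝ) / 2 *
      (((q n).1.1 - (q n).2.1) ^ 2 + ‖(q n).1.2 - (q n).2.2‖ ^ 2) ≤
      u (q n).1 - v (q n).2 - ψ (q n).1 := by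
    intro n
    have := hqmax n ((t₁, x₁), (t₁, x₁)) ⟨hz₁, hz₁⟩
    simp only [sub_self, norm_zero] at this
    norm_num at this
    linarith
  have hlim1 : Tendsto (fun n => (q (φ n)).1) atTop (𝓝 z) :=
    (continuous_fst.tendsto _).comp hlim
  have hlim2 : Tendsto (fun n => (q (φ n)).2) atTop (𝓝 w) :=
    (continuous_snd.tendsto _).comp hlim
  have hdist : z = w := by
    have hnn : ∀ n, 0 ≤ ((q n).1.1 - (q n).2.1) ^ 2 + ‖(q n).1.2 - (q n).2.2‖ ^ 2 :=
      fun n => by positivity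
    have hbd : ∀ n : ℕ, 0 < n → ((q n).1.1 - (q n).2.1) ^ 2 + ‖(q n).1.2 - (q n).2.2‖ ^ 2 ≤
        2 * (m₁ + m₂) / n := by
      intro n hn
      rw [le_div_iff₀ (Nat.cast_pos.2 hn)]
      have h1 := hlow n
      have h2 := hM _ (hqK n).1 _ (hqK n).2
      have h3 := hψ0 _ (hqK n).1.1.1
      linarith
    have h0 : Tendsto (fun n => ((q (φ n)).1.1 - (q (φ n)).2.1) ^ 2 +
        ‖(q (φ n)).1.2 - (q (φ n)).2.2‖ ^ 2) atTop (𝓝 0) := by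
      refine squeeze_zero' (Eventually.of_forall fun n => hnn _)
        ((eventually_gt_atTop 0).mono fun n hn => hbd _ (hn.trans_le (hφ.id_le n))) ?_
      exact (tendsto_const_div_atTop_nhds_zero_nat _).comp hφ.tendsto_atTop
    have h1 : Tendsto (fun n => ((q (φ n)).1.1 - (q (φ n)).2.1) ^ 2 +
        ‖(q (φ n)).1.2 - (q (φ n)).2.2‖ ^ 2) atTop
        (𝓝 ((z.1 - w.1) ^ 2 + ‖z.2 - w.2‖ ^ 2)) := by
      have hc : Continuous (fun q : (ℝ × Rd d) × (ℝ × Rd d) =>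
          (q.1.1 - q.2.1) ^ 2 + ‖q.1.2 - q.2.2‖ ^ 2) := by fun_prop
      exact (hc.tendsto (z, w)).comp hlim
    have h2 := tendsto_nhds_unique h1 h0
    have h3 : (z.1 - w.1) ^ 2 = 0 := by nlinarith [sq_nonneg (z.1 - w.1), sq_nonneg ‖z.2 - w.2‖]
    have h4 : ‖z.2 - w.2‖ ^ 2 = 0 := by linarith
    ext1
    · exact sub_eq_zero.1 (pow_eq_zero_iff two_ne_zero |>.1 h3)
    · exact sub_eq_zero.1 (norm_eq_zero.1 (pow_eq_zero_iff two_ne_zero |>.1 h4))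
  subst hdist
  -- Semicontinuity carries the gap to the limit of the maximum points.
  have hgap : σ / 2 ≤ u z - v z - ψ z := by
    have husc' := husc.add (hψc.continuous.neg.comp
      continuous_fst |>.upperSemicontinuous.upperSemicontinuousOn (K ×ˢ K))
    by_contra! hcon
    have h1 : u z + -v z + -ψ z < σ / 2 := by linarith
    have h2 := husc' (z, z) hzw (σ / 2) h1
    have h3 : Tendsto (fun n => q (φ n)) atTop (𝓝[K ×ˢ K] (z, z)) :=
      tendsto_nhdsWithin_iff.2 ⟨hlim, Eventually.of_forall fun n => hqK _⟩
    obtain ⟨n, hn⟩ := (h3.eventually h2).exists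
    have h4 := hlow (φ n)
    have h5 : 0 ≤ ((φ n : ℕ) : ℝ) / 2 * (((q (φ n)).1.1 - (q (φ n)).2.1) ^ 2 +
      ‖(q (φ n)).1.2 - (q (φ n)).2.2‖ ^ 2) := by positivity
    simp only [Function.comp, Pi.neg_apply] at hn
    linarith
  -- A positive gap excludes the initial time, where `u ≤ v`, and the rest of the boundary, where
  -- `ψ` is at least the upper bound `m₁ + m₂` of `u - v`.
  have hzint : z ∈ Ioo s b ×ˢ Metric.ball x₀ R := by
    have hzK : z ∈ K := hzw.1
    have hle := hM z hzK z hzK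
    refine ⟨⟨lt_of_le_of_ne hzK.1.1 ?_, lt_of_le_of_ne hzK.1.2 ?_⟩, ?_⟩
    · intro h
      have h1 := hinit z.2 hzK.2
      rw [h] at h1
      have := hψ0 z hzK.1.1
      simp only [Prod.mk.eta] at h1
      linarith
    · intro h
      have := hψb z hzK.1.1 h.ge
      linarith
    · rw [mem_ball_iff_norm]
      by_contra! h
      have := hψR z hzK.1.1 h
      linarith
  have hopen : IsOpen (Ioo s b ×ˢ Metric.ball x₀ R) := isOpen_Ioo.prod Metric.isOpen_ball
  have hsubK : Ioo s b ×ˢ Metric.ball x₀ R ⊆ K :=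
    prod_mono Ioo_subset_Icc_self Metric.ball_subset_closedBall
  have hest : ∀ᶠ n in atTop, η ≤ C * ‖(q (φ n)).1.2 - (q (φ n)).2.2‖ := by
    filter_upwards [hlim1.eventually (hopen.mem_nhds hzint),
      hlim2.eventually (hopen.mem_nhds hzint)] with n h1 h2
    refine doubling_estimate hF hFx hψc (hψp _) (hsub _ h1) (hsup _ h2) (n := (φ n : ℕ)) ?_
    filter_upwards [hopen.mem_nhds h1] with z' hz'
    filter_upwards [hopen.mem_nhds h2] with w' hw'
    exact hqmax (φ n) (z', w') ⟨hsubK hz', hsubK hw'⟩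
  have hto : Tendsto (fun n => C * ‖(q (φ n)).1.2 - (q (φ n)).2.2‖) atTop (𝓝 0) := by
    have hc : Continuous (fun q : (ℝ × Rd d) × (ℝ × Rd d) => C * ‖q.1.2 - q.2.2‖) := by
      fun_prop
    have := (hc.tendsto (z, z)).comp hlim
    simpa [Function.comp_def] using this
  exact absurd (ge_of_tendsto hto hest) (not_le.2 hη0)

/-! ### Half-relaxed limits of asymptotically consistent families. -/

section HalfRelaxed

variable {d : ℕ} {ι : Type*}

/-- Asymptotic one-sided consistency of a family `u` with the equation `∂_t u + F(x, D_x u) = 0`: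
affine upper bounds at time `s` propagate, in cones of speed `K`, with the speed given by `F`. -/
def UpperPropagation (l : Filter ι) (T K C : ℝ) (F : Rd d → Rd d → ℝ)
    (u : ι → ℝ × Rd d → ℝ) : Prop :=
  ∀ (x₀ θ : Rd d) (R T' η : ℝ), T' < T → 0 < η → ∀ᶠ i in l, ∀ (s t a : ℝ) (x : Rd d),
    0 ≤ s → s ≤ t → t ≤ T' → ‖x - x₀‖ + K * (t - s) + η < R →
    (∀ y ∈ Metric.closedBall x₀ R, u i (s, y) ≤ a + inner ℝ θ (y - x₀)) →
    u i (t, x) ≤ a + inner ℝ θ (x - x₀) - (t - s) * (F x₀ θ - C * R) + η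

/-- The upper half-relaxed limit of a family of functions on the strip. -/
noncomputable def upperLimit (l : Filter ι) (T : ℝ) (u : ι → ℝ × Rd d → ℝ) (z : ℝ × Rd d) : ℝ :=
  limsup (fun q : ι × (ℝ × Rd d) => u q.1 q.2) (l ×ˢ 𝓝[strip d T] z)

variable {l : Filter ι} {T K C : ℝ} {F : Rd d → Rd d → ℝ} {u : ι → ℝ × Rd d → ℝ} {g : Rd d → ℝ}

theorem openStrip_subset_strip (d : ℕ) (T : ℝ) : openStrip d T ⊆ strip d T :=
  prod_mono Ioo_subset_Ico_self subset_rfl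

theorem isOpen_openStrip (d : ℕ) (T : ℝ) : IsOpen (openStrip d T) :=
  isOpen_Ioo.prod isOpen_univ

theorem strip_mem_nhds {z : ℝ × Rd d} (hz : z ∈ openStrip d T) : strip d T ∈ 𝓝 z :=
  mem_of_superset ((isOpen_openStrip d T).mem_nhds hz) (openStrip_subset_strip d T)

/-- Propagation from time `0` with slope `0`. It yields both the local bounds that make the
half-relaxed limits finite and, with small `R`, their initial trace. -/
theorem UpperPropagation.eventually_le_of_initial (h : UpperPropagation l T K C F u)
    (hg : ∀ᶠ i in l, ∀ x, u i (0, x) = g x) {t₀ : ℝ} {x₀ : Rd d} (hz : (t₀, x₀) ∈ strip d T)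
    {R M δ : ℝ} (hR : K * t₀ < R) (hM : ∀ y ∈ Metric.closedBall x₀ R, g y ≤ M) (hδ : 0 < δ) :
    ∀ᶠ q in l ×ˢ 𝓝[strip d T] (t₀, x₀), u q.1 q.2 ≤ M - t₀ * (F x₀ 0 - C * R) + δ := by
  obtain ⟨η, hη, hηδ, hηR⟩ : ∃ η : ℝ, 0 < η ∧ η < δ ∧ K * t₀ + η < R :=
    ⟨min (δ / 2) ((R - K * t₀) / 2), lt_min (by linarith) (by linarith),
      (min_le_left _ _).trans_lt (by linarith),
      by linarith [min_le_right (δ / 2) ((R - K * t₀) / 2)]⟩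
  have ht₀ : t₀ < T := hz.1.2
  have hc1 : ∀ᶠ z in 𝓝 ((t₀, x₀) : ℝ × Rd d), ‖z.2 - x₀‖ + K * (z.1 - 0) + η < R :=
    ContinuousAt.eventually_lt (by fun_prop) continuousAt_const (by simpa using hηR)
  have hc2 : ∀ᶠ z in 𝓝 ((t₀, x₀) : ℝ × Rd d), z.1 < (t₀ + T) / 2 :=
    ContinuousAt.eventually_lt (by fun_prop) continuousAt_const (by simp only; linarith)
  have hc3 : ∀ᶠ z in 𝓝 ((t₀, x₀) : ℝ × Rd d),
      M - (z.1 - 0) * (F x₀ 0 - C * R) + η < M - t₀ * (F x₀ 0 - C * R) + δ :=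
    ContinuousAt.eventually_lt (by fun_prop) continuousAt_const (by simpa using hηδ)
  have hz' := ((hc1.and (hc2.and hc3)).filter_mono nhdsWithin_le_nhds).and
    (self_mem_nhdsWithin (s := strip d T) (a := ((t₀, x₀) : ℝ × Rd d)))
  filter_upwards [(hg.and (h x₀ 0 R ((t₀ + T) / 2) η (by linarith) hη)).prod_mk hz'] with q hq
  obtain ⟨⟨hq1, hq2⟩, ⟨hq3, hq4, hq5⟩, hq6⟩ := hq
  have := hq2 0 q.2.1 M q.2.2 le_rfl hq6.1.1 hq4.le hq3 (fun y hy => by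
    rw [hq1, inner_zero_left, add_zero]
    exact hM y hy)
  rw [inner_zero_left, add_zero] at this
  exact this.trans hq5.le

theorem UpperPropagation.exists_eventually_le (h : UpperPropagation l T K C F u)
    (hg : ∀ᶠ i in l, ∀ x, u i (0, x) = g x) (hgc : Continuous g) {z : ℝ × Rd d}
    (hz : z ∈ strip d T) : ∃ c, ∀ᶠ q in l ×ˢ 𝓝[strip d T] z, u q.1 q.2 ≤ c := by
  obtain ⟨M, hM⟩ := (isCompact_closedBall z.2 (K * z.1 + 1)).bddAbove_image hgc.continuousOn
  exact ⟨_, h.eventually_le_of_initial hg hz (lt_add_one _)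
    (fun y hy => hM (mem_image_of_mem g hy)) one_pos⟩

/-- A real `limsup` needs bounds on both sides to be meaningful; the lower one is an upper bound for
`-u`, which propagation for the dual equation supplies. -/
theorem upperLimit_le [l.NeBot] {z : ℝ × Rd d} (hz : z ∈ strip d T)
    (hb : ∃ c, ∀ᶠ q in l ×ˢ 𝓝[strip d T] z, -u q.1 q.2 ≤ c) {c : ℝ}
    (h : ∀ᶠ q in l ×ˢ 𝓝[strip d T] z, u q.1 q.2 ≤ c) : upperLimit l T u z ≤ c := by
  have : (𝓝[strip d T] z).NeBot := nhdsWithin_neBot_of_mem hz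
  obtain ⟨b, hb⟩ := hb
  have hbdd : IsBoundedUnder (· ≥ ·) (l ×ˢ 𝓝[strip d T] z)
      (fun q : ι × (ℝ × Rd d) => u q.1 q.2) :=
    ⟨-b, eventually_map.2 (hb.mono fun q hq => by simp only [ge_iff_le]; linarith)⟩
  exact limsup_le_of_le hbdd.isCoboundedUnder_le h

theorem eventually_lt_of_upperLimit_lt {z : ℝ × Rd d}
    (hb : ∃ c, ∀ᶠ q in l ×ˢ 𝓝[strip d T] z, u q.1 q.2 ≤ c) {c : ℝ}
    (h : upperLimit l T u z < c) : ∀ᶠ q in l ×ˢ 𝓝[strip d T] z, u q.1 q.2 < c := by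
  obtain ⟨b, hb⟩ := hb
  exact eventually_lt_of_limsup_lt h ⟨b, eventually_map.2 hb⟩

theorem upperLimit_upperSemicontinuousOn [l.NeBot]
    (hb : ∀ z ∈ strip d T, ∃ c, ∀ᶠ q in l ×ˢ 𝓝[strip d T] z, u q.1 q.2 ≤ c)
    (hb' : ∀ z ∈ strip d T, ∃ c, ∀ᶠ q in l ×ˢ 𝓝[strip d T] z, -u q.1 q.2 ≤ c) :
    UpperSemicontinuousOn (upperLimit l T u) (strip d T) := by
  intro z hz c hc
  obtain ⟨c', hc', hc'c⟩ := exists_between hc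
  obtain ⟨pa, ha, pb, hpb, hab⟩ := eventually_prod_iff.1
    (eventually_lt_of_upperLimit_lt (hb z hz) hc')
  filter_upwards [eventually_eventually_nhdsWithin.2 hpb, self_mem_nhdsWithin] with w hw hws
  refine (upperLimit_le hws (hb' w hws) ?_).trans_lt hc'c
  filter_upwards [ha.prod_mk hw] with q hq
  exact (hab hq.1 hq.2).le

/-- If the test failed with excess `A > 0`, the family at time `t₀ - r` would lie below an affine
function of slope `p`, up to small errors. Propagation over time `r` would give `U ≤ U - r * A` plus
three errors of at most `r * A / 4` each, which is absurd. -/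
theorem UpperPropagation.subsolutionTest_upperLimit [l.NeBot] (hK : 0 ≤ K)
    (h : UpperPropagation l T K C F u)
    (hb : ∀ z ∈ strip d T, ∃ c, ∀ᶠ q in l ×ˢ 𝓝[strip d T] z, u q.1 q.2 ≤ c)
    (hb' : ∀ z ∈ strip d T, ∃ c, ∀ᶠ q in l ×ˢ 𝓝[strip d T] z, -u q.1 q.2 ≤ c) :
    SubsolutionTest T F (upperLimit l T u) := by
  rintro φ hφ ⟨t₀, x₀⟩ hz hmax
  have hd : DifferentiableAt ℝ φ (t₀, x₀) :=
    ((hφ.differentiableOn one_ne_zero).differentiableAt ((isOpen_openStrip d T).mem_nhds hz))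
  obtain ⟨a, p, hap, hL⟩ := HasPartials.of_hasFDerivAt hd.hasFDerivAt
  rw [hap.hjOperator_eq]
  simp only
  by_contra! hA
  set A := a + F x₀ p with hAdef
  -- Chosen so that `κ * (R + r) = r * A / 4` when `R = (K + 1) * r`; this radius contains the base
  -- of the cone of height `r` with room `r` for `η`.
  set κ := A / (4 * (K + 2)) with hκ
  have hκ0 : 0 < κ := by positivity
  have hloc : ∀ᶠ z in 𝓝 ((t₀, x₀) : ℝ × Rd d), upperLimit l T u z ≤ upperLimit l T u (t₀, x₀) +
      ((z.1 - t₀) * a + inner ℝ p (z.2 - x₀)) + κ * ‖z - (t₀, x₀)‖ := by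
    filter_upwards [hmax, hd.hasFDerivAt.isLittleO.def hκ0] with z h1 h2
    rw [hL] at h2
    have h3 := (abs_le.1 h2).2
    simp only [Prod.fst_sub, Prod.snd_sub] at h3
    linarith
  obtain ⟨ε, hε, hball⟩ := Metric.eventually_nhds_iff.1 hloc
  have ht₀ : 0 < t₀ ∧ t₀ < T := hz.1
  obtain ⟨r, hr, hrt, hrC, hrε⟩ : ∃ r : ℝ, 0 < r ∧ r < t₀ ∧ C * ((K + 1) * r) ≤ A / 4 ∧
      (K + 1) * r < ε := by
    have e1 : ∀ᶠ r in 𝓝 (0 : ℝ), r < t₀ := eventually_lt_nhds ht₀.1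
    have e2 : ∀ᶠ r in 𝓝 (0 : ℝ), C * ((K + 1) * r) < A / 4 :=
      ContinuousAt.eventually_lt (by fun_prop) continuousAt_const (by simpa using hA)
    have e3 : ∀ᶠ r in 𝓝 (0 : ℝ), (K + 1) * r < ε :=
      ContinuousAt.eventually_lt (by fun_prop) continuousAt_const (by simpa using hε)
    obtain ⟨r, ⟨h1, h2, h3⟩, h4⟩ := (((e1.and (e2.and e3)).filter_mono nhdsWithin_le_nhds).and
      (self_mem_nhdsWithin (s := Ioi (0 : ℝ)))).exists
    exact ⟨r, h4, h1, h2.le, h3⟩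
  set R := (K + 1) * r with hRdef
  set s := t₀ - r with hs
  set U := upperLimit l T u (t₀, x₀) with hU
  set a' := U - r * a + κ * R + κ * r with ha'
  have hrR : r ≤ R := by nlinarith
  -- Compactness of the ball makes the pointwise `limsup` bounds uniform in `y`.
  have hslice : ∀ᶠ i in l, ∀ y ∈ Metric.closedBall x₀ R, u i (s, y) ≤ a' + inner ℝ p (y - x₀) := by
    have hpt : ∀ y ∈ Metric.closedBall x₀ R,
        {q : ι × Rd d | u q.1 (s, q.2) ≤ a' + inner ℝ p (q.2 - x₀)} ∈ l ×ˢ 𝓝 y := by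
      intro y hy
      have hys : ((s, y) : ℝ × Rd d) ∈ strip d T := ⟨⟨by linarith, by linarith⟩, mem_univ _⟩
      have hnorm : ‖((s, y) : ℝ × Rd d) - (t₀, x₀)‖ ≤ R := by
        rw [Prod.mk_sub_mk, Prod.norm_mk, hs, Real.norm_eq_abs, sub_sub_cancel_left, abs_neg,
          abs_of_pos hr]
        exact max_le hrR (mem_closedBall_iff_norm.1 hy)
      have h1 := hball (y := (s, y)) (by rw [dist_eq_norm]; exact hnorm.trans_lt hrε)
      have h2 : upperLimit l T u (s, y) < a' + inner ℝ p (y - x₀) := by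
        have h3 := mul_le_mul_of_nonneg_left hnorm hκ0.le
        have h4 : 0 < κ * r := by positivity
        have h5 : (s - t₀) * a = -(r * a) := by rw [hs]; ring
        simp only [h5] at h1
        linarith
      obtain ⟨c, hc, hc'⟩ := exists_between h2
      have h3 := eventually_lt_of_upperLimit_lt (hb _ hys) hc
      have h4 : Tendsto (fun y' : Rd d => ((s, y') : ℝ × Rd d)) (𝓝 y) (𝓝[strip d T] (s, y)) :=
        tendsto_nhdsWithin_iff.2 ⟨(Continuous.prodMk_right s).tendsto' _ _ rfl,
          Eventually.of_forall fun y' => ⟨hys.1, mem_univ _⟩⟩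
      have h5 := ((tendsto_id (x := l)).prodMap h4).eventually h3
      have h6 : ∀ᶠ y' in 𝓝 y, c < a' + inner ℝ p (y' - x₀) :=
        ContinuousAt.eventually_lt continuousAt_const (by fun_prop) hc'
      filter_upwards [h5, h6.prod_inr l] with q hq1 hq2
      exact (hq1.trans hq2).le
    have := (isCompact_closedBall x₀ R).mem_prod_nhdsSet_of_forall hpt
    obtain ⟨pa, ha, pb, hpb, hab⟩ := eventually_prod_iff.1 this
    filter_upwards [ha] with i hi y hy
    exact hab hi (hpb.self_of_nhdsSet y hy)
  obtain ⟨η, hη, hηA, hηr⟩ : ∃ η : ℝ, 0 < η ∧ 2 * η ≤ r * A / 4 ∧ η < r :=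
    ⟨min (r * A / 8) (r / 2), lt_min (by positivity) (by positivity),
      by linarith [min_le_left (r * A / 8) (r / 2)], by linarith [min_le_right (r * A / 8) (r / 2)]⟩
  have hc1 : ∀ᶠ z in 𝓝 ((t₀, x₀) : ℝ × Rd d), ‖z.2 - x₀‖ + K * (z.1 - s) + η < R := by
    refine ContinuousAt.eventually_lt (by fun_prop) continuousAt_const ?_
    simp only [sub_self, norm_zero, hs, hRdef]
    linarith
  have hc2 : ∀ᶠ z in 𝓝 ((t₀, x₀) : ℝ × Rd d), z.1 < (t₀ + T) / 2 :=
    ContinuousAt.eventually_lt (by fun_prop) continuousAt_const (by simp only; linarith)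
  have hc3 : ∀ᶠ z in 𝓝 ((t₀, x₀) : ℝ × Rd d), s < z.1 :=
    ContinuousAt.eventually_lt continuousAt_const (by fun_prop) (by simp only; linarith)
  have hc4 : ∀ᶠ z in 𝓝 ((t₀, x₀) : ℝ × Rd d),
      a' + inner ℝ p (z.2 - x₀) - (z.1 - s) * (F x₀ p - C * R) + η <
      a' - r * (F x₀ p - C * R) + 2 * η := by
    refine ContinuousAt.eventually_lt (by fun_prop) continuousAt_const ?_
    simp only [sub_self, inner_zero_right, hs, sub_sub_cancel]
    linarith
  have hz' := ((hc1.and (hc2.and (hc3.and hc4))).filter_mono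
    (nhdsWithin_le_nhds (s := strip d T)))
  have hfin : U ≤ a' - r * (F x₀ p - C * R) + 2 * η := by
    have hzs := openStrip_subset_strip d T hz
    refine upperLimit_le hzs (hb' _ hzs) ?_
    filter_upwards [(hslice.and (h x₀ p R ((t₀ + T) / 2) η (by linarith) hη)).prod_mk hz'] with q hq
    obtain ⟨⟨hq1, hq2⟩, hq3, hq4, hq5, hq6⟩ := hq
    exact (hq2 s q.2.1 a' q.2.2 (by linarith) hq5.le hq4.le hq3 hq1).trans hq6.le
  have e1 : κ * R + κ * r = r * A / 4 := by
    rw [hκ, hRdef]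
    field_simp
    ring
  have e2 : r * (C * R) ≤ r * (A / 4) := mul_le_mul_of_nonneg_left hrC hr.le
  have e3 : 0 < r * A := by positivity
  have e4 : r * A = r * a + r * F x₀ p := by rw [hAdef]; ring
  rw [ha'] at hfin
  linarith

theorem UpperPropagation.upperLimit_zero_le [l.NeBot] (hT : 0 < T)
    (h : UpperPropagation l T K C F u) (hg : ∀ᶠ i in l, ∀ x, u i (0, x) = g x)
    (hgc : Continuous g)
    (hb' : ∀ z ∈ strip d T, ∃ c, ∀ᶠ q in l ×ˢ 𝓝[strip d T] z, -u q.1 q.2 ≤ c) (x : Rd d) :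
    upperLimit l T u (0, x) ≤ g x := by
  have hz : ((0, x) : ℝ × Rd d) ∈ strip d T := ⟨⟨le_rfl, hT⟩, mem_univ _⟩
  refine le_of_forall_pos_le_add fun δ hδ => upperLimit_le hz (hb' _ hz) ?_
  obtain ⟨R, hR, hball⟩ := Metric.continuous_iff.1 hgc x (δ / 2) (by positivity)
  have := h.eventually_le_of_initial hg hz (R := R / 2) (M := g x + δ / 2) (δ := δ / 2)
    (by linarith) (fun y hy => by
      have := hball y ((Metric.mem_closedBall.1 hy).trans_lt (by linarith))
      rw [Real.dist_eq] at this
      linarith [(abs_lt.1 this).2]) (by positivity)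
  filter_upwards [this] with q hq
  linarith

theorem SupersolutionTest.congr {v w : ℝ × Rd d → ℝ} (h : SupersolutionTest T F v)
    (hvw : EqOn v w (strip d T)) : SupersolutionTest T F w := by
  intro φ hφ z hz hmin
  refine h φ hφ z hz (hmin.congr ?_)
  filter_upwards [strip_mem_nhds hz] with y hy
  rw [hvw hy]

/-- Half-relaxed limits: a family which is asymptotically consistent from both sides converges
locally uniformly to a solution of the Cauchy problem. -/
theorem exists_cauchySolution_of_upperPropagation [l.NeBot] {β : ℝ} (hT : 0 < T) (hβ : 0 ≤ β)
    (hF : CondH2 β F) (hFx : CondH3 C F) (hK : 0 ≤ K) (hgc : Continuous g)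
    (hg : ∀ᶠ i in l, ∀ x, u i (0, x) = g x) (h : UpperPropagation l T K C F u)
    (h' : UpperPropagation l T K C (dualHamiltonian F) (fun i z => -u i z)) :
    ∃ v, IsCauchySolution T F g v ∧
      ∀ Q : Set (ℝ × Rd d), IsCompact Q → Q ⊆ strip d T → TendstoUniformlyOn u v l Q := by
  have hg' : ∀ᶠ i in l, ∀ x, -u i (0, x) = -g x := hg.mono fun i hi x => by rw [hi]
  have hb : ∀ z ∈ strip d T, ∃ c, ∀ᶠ q in l ×ˢ 𝓝[strip d T] z, u q.1 q.2 ≤ c :=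
    fun z hz => h.exists_eventually_le hg hgc hz
  have hb' : ∀ z ∈ strip d T, ∃ c, ∀ᶠ q in l ×ˢ 𝓝[strip d T] z, -u q.1 q.2 ≤ c :=
    fun z hz => h'.exists_eventually_le hg' hgc.neg hz
  have hb'' : ∀ z ∈ strip d T, ∃ c, ∀ᶠ q in l ×ˢ 𝓝[strip d T] z, - -u q.1 q.2 ≤ c := by
    simpa only [neg_neg] using hb
  set v := upperLimit l T u with hv
  set w := upperLimit l T (fun i z => -u i z) with hw
  have hvs : UpperSemicontinuousOn v (strip d T) := upperLimit_upperSemicontinuousOn hb hb'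
  have hws : UpperSemicontinuousOn w (strip d T) := upperLimit_upperSemicontinuousOn hb' hb''
  have hsub : SubsolutionTest T F v := h.subsolutionTest_upperLimit hK hb hb'
  have hsup : SupersolutionTest T F (fun z => -w z) := by
    have := (h'.subsolutionTest_upperLimit hK hb' hb'').neg
    rwa [dualHamiltonian_dualHamiltonian] at this
  have hv0 : ∀ x, v (0, x) ≤ g x := h.upperLimit_zero_le hT hg hgc hb'
  have hw0 : ∀ x, w (0, x) ≤ -g x := h'.upperLimit_zero_le hT hg' hgc.neg hb''
  have hle : ∀ z ∈ strip d T, -w z ≤ v z := by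
    intro z hz
    have : (𝓝[strip d T] z).NeBot := nhdsWithin_neBot_of_mem hz
    by_contra! hlt
    obtain ⟨c, hc1, hc2⟩ := exists_between hlt
    obtain ⟨q, hq1, hq2⟩ := ((eventually_lt_of_upperLimit_lt (hb z hz) hc1).and
      (eventually_lt_of_upperLimit_lt (hb' z hz) (lt_neg.1 hc2))).exists
    linarith
  -- The lower limit `-w` never exceeds the upper limit `v`; comparison of the subsolution `v` with
  -- the supersolution `-w` gives the converse, so their common value is continuous.
  have heq : ∀ z ∈ strip d T, -w z = v z := by
    rintro ⟨t, x⟩ hz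
    refine le_antisymm (hle _ hz) ?_
    have ht : 0 ≤ t ∧ t < T := hz.1
    have hss : Icc 0 ((t + T) / 2) ×ˢ Metric.closedBall x (β * t + 1) ⊆ strip d T :=
      prod_mono (fun y hy => ⟨hy.1, hy.2.trans_lt (by linarith)⟩) (subset_univ _)
    have hos : Ioo 0 ((t + T) / 2) ×ˢ Metric.ball x (β * t + 1) ⊆ openStrip d T :=
      prod_mono (fun y hy => ⟨hy.1, hy.2.trans (by linarith)⟩) (subset_univ _)
    refine cone_le (v := fun z => -w z) (x₀ := x) (R := β * t + 1) hβ hF hFx (hvs.mono hss) ?_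
      (fun z hz => hsub.subsolutionAt (hos hz)) (fun z hz => hsup.supersolutionAt (hos hz))
      (fun y _ => by linarith [hv0 y, hw0 y]) ⟨ht.1, by linarith⟩ (by simp)
    simpa only [neg_neg] using hws.mono hss
  have hloc : ∀ z ∈ strip d T, ∀ δ > 0, ∀ᶠ q in l ×ˢ 𝓝[strip d T] z, |u q.1 q.2 - v z| < δ := by
    intro z hz δ hδ
    filter_upwards [eventually_lt_of_upperLimit_lt (hb z hz) (lt_add_of_pos_right (v z) hδ),
      eventually_lt_of_upperLimit_lt (hb' z hz) (lt_add_of_pos_right (w z) hδ)] with q h1 h2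
    have := heq z hz
    rw [abs_lt]
    constructor <;> linarith
  have hcont : ContinuousOn v (strip d T) := by
    intro z hz
    refine Metric.tendsto_nhds.2 fun δ hδ => ?_
    filter_upwards [hvs z hz _ (lt_add_of_pos_right (v z) hδ),
      hws z hz _ (lt_add_of_pos_right (w z) hδ), self_mem_nhdsWithin] with y h1 h2 hy
    have := heq z hz
    have := heq y hy
    rw [Real.dist_eq, abs_lt]
    constructor <;> linarith
  refine ⟨v, ⟨hcont, hsub, hsup.congr heq, fun x => ?_⟩, fun Q hQ hQs => ?_⟩
  · have := heq (0, x) ⟨⟨le_rfl, hT⟩, mem_univ _⟩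
    exact le_antisymm (hv0 x) (by linarith [hw0 x])
  · rw [← tendstoLocallyUniformlyOn_iff_tendstoUniformlyOn_of_compact hQ,
      Metric.tendstoLocallyUniformlyOn_iff]
    intro δ hδ z hz
    have h1 := hloc z (hQs hz) (δ / 2) (by positivity)
    have h2 : ∀ᶠ y in 𝓝[strip d T] z, dist (v y) (v z) < δ / 2 :=
      Metric.tendsto_nhds.1 (hcont z (hQs hz)) (δ / 2) (by positivity)
    obtain ⟨pa, ha, pb, hpb, hab⟩ := eventually_prod_iff.1 (h1.and (h2.prod_inr l))
    refine ⟨{y | pb y}, nhdsWithin_mono z hQs hpb, ha.mono fun i hi y hy => ?_⟩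
    obtain ⟨e1, e2⟩ := hab hi hy
    rw [Real.dist_eq] at e2 ⊢
    rw [abs_lt] at *
    constructor <;> linarith [e1.1, e1.2, e2.1, e2.2]

end HalfRelaxed

/-! ### Existence by a monotone finite difference scheme. -/

section Scheme

variable {d : ℕ}

/-- One step of an explicit monotone finite difference scheme for `∂_t u + F(x, D_x u) = 0`, with
time step `τ` and space step `h = (d + 1) β τ`. -/
noncomputable def schemeStep (β τ : ℝ) (F : Rd d → Rd d → ℝ) (v : Rd d → ℝ) (x : Rd d) : ℝ :=
  v x + 1 / (2 * (d + 1)) * ∑ i, (v (x + ((d + 1) * β * τ) • EuclideanSpace.single i 1) +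
    v (x - ((d + 1) * β * τ) • EuclideanSpace.single i 1) - 2 * v x) -
  τ * F x (∑ i, ((v (x + ((d + 1) * β * τ) • EuclideanSpace.single i 1) -
    v (x - ((d + 1) * β * τ) • EuclideanSpace.single i 1)) / (2 * ((d + 1) * β * τ))) •
      EuclideanSpace.single i 1)

variable {β τ : ℝ} {F : Rd d → Rd d → ℝ}

/-- With space step `h = (d + 1) β τ`, one has `τ β / (2 h) = 1 / (2 (d + 1))`: by (H2) the
variation of `F` is at most what the averaging of neighbours gains, and the centre keeps the weight
`1 / (d + 1)`. -/
theorem schemeStep_mono (hβ : 0 < β) (hτ : 0 < τ) (hF : CondH2 β F) {v w : Rd d → ℝ} {x : Rd d}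
    (h : ∀ y ∈ Metric.closedBall x ((d + 1) * β * τ), v y ≤ w y) :
    schemeStep β τ F v x ≤ schemeStep β τ F w x := by
  unfold schemeStep
  set r : ℝ := (d + 1) * β * τ with hr
  have hr0 : 0 < r := by positivity
  set e : Fin d → Rd d := fun i => EuclideanSpace.single i 1 with he
  have hen : ∀ i, ‖e i‖ = 1 := fun i => by simp [he]
  have h0 : v x ≤ w x := h x (Metric.mem_closedBall_self hr0.le)
  have hp : ∀ i, v (x + r • e i) ≤ w (x + r • e i) := fun i => h _ (by
    rw [mem_closedBall_iff_norm, add_sub_cancel_left, norm_smul, hen, mul_one,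
      Real.norm_of_nonneg hr0.le])
  have hm : ∀ i, v (x - r • e i) ≤ w (x - r • e i) := fun i => h _ (by
    rw [mem_closedBall_iff_norm, sub_sub_cancel_left, norm_neg, norm_smul, hen, mul_one,
      Real.norm_of_nonneg hr0.le])
  set S : ℝ := ∑ i, ((w (x + r • e i) - v (x + r • e i)) + (w (x - r • e i) - v (x - r • e i)))
    with hS
  have hFd := (abs_le.1 (hF x (∑ i, ((w (x + r • e i) - w (x - r • e i)) / (2 * r)) • e i)
    (∑ i, ((v (x + r • e i) - v (x - r • e i)) / (2 * r)) • e i))).2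
  have hnorm : ‖∑ i, ((w (x + r • e i) - w (x - r • e i)) / (2 * r)) • e i -
      ∑ i, ((v (x + r • e i) - v (x - r • e i)) / (2 * r)) • e i‖ ≤ S / (2 * r) := by
    rw [← Finset.sum_sub_distrib, hS, Finset.sum_div]
    refine norm_sum_le_of_le _ fun i _ => ?_
    rw [← sub_smul, norm_smul, hen, mul_one, ← sub_div, norm_div,
      Real.norm_of_nonneg (by positivity : 0 ≤ 2 * r)]
    gcongr
    rw [Real.norm_eq_abs, abs_le]
    constructor <;> linarith [hp i, hm i]
  have hkey : τ * (β * (S / (2 * r))) = 1 / (2 * (d + 1)) * S := by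
    rw [hr]
    field_simp
  have h1 := mul_le_mul_of_nonneg_left (hFd.trans (mul_le_mul_of_nonneg_left hnorm hβ.le)) hτ.le
  rw [hkey] at h1
  have h2 : ∀ f : Rd d → ℝ, ∑ i, (f (x + r • e i) + f (x - r • e i) - 2 * f x) =
      ∑ i, (f (x + r • e i) + f (x - r • e i)) - 2 * d * f x := fun f => by
    rw [Finset.sum_sub_distrib]
    simp
    ring
  have h3 : S = ∑ i, (w (x + r • e i) + w (x - r • e i)) -
      ∑ i, (v (x + r • e i) + v (x - r • e i)) := by
    rw [hS, ← Finset.sum_sub_distrib]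
    exact Finset.sum_congr rfl fun i _ => by ring
  have h4 : ∀ c : ℝ, c - 1 / (2 * (d + 1)) * (2 * d * c) = c / (d + 1) := fun c => by
    field_simp
    ring
  have h5 : v x / (d + 1) ≤ w x / (d + 1) := by gcongr
  rw [h2 v, h2 w, mul_sub, mul_sub]
  rw [h3, mul_sub] at h1
  linarith [h4 (v x), h4 (w x)]

/-- Exact consistency: second differences of an affine function vanish and its central differences
return the slope. -/
theorem schemeStep_affine (hβ : 0 < β) (hτ : 0 < τ) (a : ℝ) (θ x₀ x : Rd d) :
    schemeStep β τ F (fun y => a + inner ℝ θ (y - x₀)) x =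
      a + inner ℝ θ (x - x₀) - τ * F x θ := by
  unfold schemeStep
  set r : ℝ := (d + 1) * β * τ with hr
  have hr0 : 0 < r := by positivity
  have h1 : ∀ i : Fin d, a + inner ℝ θ (x + r • EuclideanSpace.single i 1 - x₀) +
      (a + inner ℝ θ (x - r • EuclideanSpace.single i 1 - x₀)) -
      2 * (a + inner ℝ θ (x - x₀)) = 0 := fun i => by
    simp only [inner_sub_right, inner_add_right]
    ring
  have h2 : ∑ i : Fin d, ((a + inner ℝ θ (x + r • EuclideanSpace.single i 1 - x₀) -
      (a + inner ℝ θ (x - r • EuclideanSpace.single i 1 - x₀))) / (2 * r)) •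
      (EuclideanSpace.single i 1 : Rd d) = θ := by
    have h3 : ∀ i : Fin d, (a + inner ℝ θ (x + r • EuclideanSpace.single i 1 - x₀) -
      (a + inner ℝ θ (x - r • EuclideanSpace.single i 1 - x₀))) / (2 * r) = θ i := fun i => by
      simp only [inner_sub_right, inner_add_right, inner_smul_right,
        EuclideanSpace.inner_single_right]
      simp
      field_simp
      ring
    simp only [h3]
    ext j
    simp [Finset.sum_apply, Pi.single_apply]
  rw [h2]
  simp only [h1, Finset.sum_const_zero, mul_zero, add_zero]

theorem schemeStep_neg (v : Rd d → ℝ) :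
    schemeStep β τ (dualHamiltonian F) (fun y => -v y) = fun x => -schemeStep β τ F v x := by
  ext x
  unfold schemeStep dualHamiltonian
  rw [← Finset.sum_neg_distrib]
  simp only [← neg_smul]
  have h1 : ∀ A B : ℝ, -((-A - -B) / (2 * ((d + 1) * β * τ))) =
      (A - B) / (2 * ((d + 1) * β * τ)) := fun A B => by ring
  have h2 : ∀ A B D : ℝ, -A + -B - 2 * -D = -(A + B - 2 * D) := fun A B D => by ring
  simp only [h1, h2, Finset.sum_neg_distrib]
  ring

theorem iterate_schemeStep_neg (v : Rd d → ℝ) (n : ℕ) :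
    (schemeStep β τ (dualHamiltonian F))^[n] (fun y => -v y) =
      fun x => -(schemeStep β τ F)^[n] v x := by
  induction n with
  | zero => rfl
  | succ n ih => simp only [Function.iterate_succ_apply', ih, schemeStep_neg]

/-- Each step shrinks the domain of dependence by one space step. The iterates involved stay in the
ball of radius `R`, where `F x θ ≥ F x₀ θ - C * R`. -/
theorem iterate_schemeStep_le {C : ℝ} (hβ : 0 < β) (hτ : 0 < τ) (hC : 0 ≤ C) (hF : CondH2 β F)
    (hFx : CondH3 C F) {v : Rd d → ℝ} {a R : ℝ} {θ x₀ : Rd d}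
    (h : ∀ y ∈ Metric.closedBall x₀ R, v y ≤ a + inner ℝ θ (y - x₀)) (n : ℕ) (x : Rd d)
    (hx : ‖x - x₀‖ + n * ((d + 1) * β * τ) ≤ R) :
    (schemeStep β τ F)^[n] v x ≤ a + inner ℝ θ (x - x₀) - n * τ * (F x₀ θ - C * R) := by
  have hr0 : 0 < (d + 1) * β * τ := by positivity
  induction n generalizing x with
  | zero =>
    simp only [Nat.cast_zero, zero_mul, add_zero, sub_zero] at hx ⊢
    exact h x (mem_closedBall_iff_norm.2 hx)
  | succ n ih =>
    rw [Function.iterate_succ_apply']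
    push_cast at hx ⊢
    refine (schemeStep_mono (w := fun y => (a - n * τ * (F x₀ θ - C * R)) + inner ℝ θ (y - x₀))
      hβ hτ hF fun y hy => ?_).trans ?_
    · have h1 : ‖y - x₀‖ ≤ ‖y - x‖ + ‖x - x₀‖ := norm_sub_le_norm_sub_add_norm_sub y x x₀
      have h2 := mem_closedBall_iff_norm.1 hy
      have := ih y (by linarith)
      linarith
    · rw [schemeStep_affine hβ hτ]
      have h1 := (abs_le.1 (hFx x x₀ θ)).1
      have h2 : ‖x - x₀‖ ≤ R := by nlinarith
      have h3 := mul_le_mul_of_nonneg_left h2 hC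
      have h4 : τ * (F x₀ θ - C * R) ≤ τ * F x θ := by
        gcongr
        linarith
      linarith

/-- The time-step-`1/(n+1)` approximation, piecewise constant in time. -/
noncomputable def schemeApprox (β : ℝ) (F : Rd d → Rd d → ℝ) (g : Rd d → ℝ) (n : ℕ)
    (z : ℝ × Rd d) : ℝ :=
  (schemeStep β (1 / ((n : ℝ) + 1)) F)^[⌊z.1 * ((n : ℝ) + 1)⌋₊] g z.2

/-- The number of steps between `s` and `t` differs from `(t - s) * (n + 1)` by at most one; `η`
absorbs this rounding in both the cone and the value. -/
theorem schemeApprox_upperPropagation {C : ℝ} (hβ : 0 < β) (hC : 0 ≤ C) (hF : CondH2 β F)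
    (hFx : CondH3 C F) (g : Rd d → ℝ) (T : ℝ) :
    UpperPropagation atTop T ((d + 1) * β) C F (schemeApprox β F g) := by
  intro x₀ θ R T' η _ hη
  have hτ : Tendsto (fun n : ℕ => 1 / ((n : ℝ) + 1)) atTop (𝓝 0) :=
    tendsto_one_div_add_atTop_nhds_zero_nat
  have e1 : ∀ᶠ n : ℕ in atTop, (d + 1) * β * (1 / ((n : ℝ) + 1)) < η :=
    (hτ.const_mul ((d + 1) * β)).eventually_lt_const (by simpa using hη)
  have e2 : ∀ᶠ n : ℕ in atTop, |F x₀ θ - C * R| * (1 / ((n : ℝ) + 1)) < η :=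
    (hτ.const_mul |F x₀ θ - C * R|).eventually_lt_const (by simpa using hη)
  filter_upwards [e1, e2] with n h1 h2 s t a x hs hst _ hx hinit
  set N : ℝ := (n : ℝ) + 1 with hN
  have hN0 : 0 < N := by positivity
  obtain ⟨m, hm⟩ : ∃ m : ℕ, ⌊t * N⌋₊ = m + ⌊s * N⌋₊ := by
    have : ⌊s * N⌋₊ ≤ ⌊t * N⌋₊ := Nat.floor_mono (by gcongr)
    exact ⟨_, (Nat.sub_add_cancel this).symm⟩
  have hm' : (⌊t * N⌋₊ : ℝ) = m + ⌊s * N⌋₊ := by exact_mod_cast hm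
  have ht1 := Nat.floor_le (a := t * N) (by have := hs.trans hst; positivity)
  have ht2 := Nat.lt_floor_add_one (t * N)
  have hs1 := Nat.floor_le (a := s * N) (by positivity)
  have hs2 := Nat.lt_floor_add_one (s * N)
  have hmu : m * (1 / N) ≤ t - s + 1 / N := by
    rw [mul_one_div, ← sub_le_iff_le_add, ← sub_div, div_le_iff₀ hN0]
    linarith
  have hml : t - s - 1 / N ≤ m * (1 / N) := by
    rw [mul_one_div, sub_le_iff_le_add, ← add_div, le_div_iff₀ hN0]
    linarith
  have key := iterate_schemeStep_le hβ (τ := 1 / N) (by positivity) hC hF hFx hinit m x (by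
    have := mul_le_mul_of_nonneg_left hmu (by positivity : 0 ≤ (d + 1) * β)
    linarith)
  have hit : schemeApprox β F g n (t, x) =
      (schemeStep β (1 / N) F)^[m] (fun y => schemeApprox β F g n (s, y)) x := by
    simp only [schemeApprox]
    rw [← hN, hm, Function.iterate_add_apply]
  rw [hit]
  refine key.trans ?_
  have h3 : |(t - s - m * (1 / N)) * (F x₀ θ - C * R)| ≤ 1 / N * |F x₀ θ - C * R| := by
    rw [abs_mul]
    gcongr
    rw [abs_le]
    constructor <;> linarith
  have h4 := (abs_le.1 h3).2
  linarith

theorem exists_isCauchySolution {T C : ℝ} (hT : 0 < T) (hβ : 0 < β) (hC : 0 ≤ C)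
    (hF : CondH2 β F) (hFx : CondH3 C F) {g : Rd d → ℝ} (hg : Continuous g) :
    ∃ u, IsCauchySolution T F g u := by
  have h' : UpperPropagation atTop T ((d + 1) * β) C (dualHamiltonian F)
      (fun n z => -schemeApprox β F g n z) := by
    have := schemeApprox_upperPropagation hβ hC hF.dual hFx.dual (fun y => -g y) T
    convert this using 3 with n z
    simp only [schemeApprox, iterate_schemeStep_neg]
  obtain ⟨u, hu, -⟩ := exists_cauchySolution_of_upperPropagation hT hβ.le hF hFx
    (by positivity) hg (Eventually.of_forall fun n x => by simp [schemeApprox])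
    (schemeApprox_upperPropagation hβ hC hF hFx g T) h'
  exact ⟨u, hu⟩

/-! ### Comparison and uniqueness on the whole strip. -/

theorem IsCauchySolution.le {T C : ℝ} (hβ : 0 ≤ β) (hF : CondH2 β F) (hFx : CondH3 C F)
    {g g' : Rd d → ℝ} {u v : ℝ × Rd d → ℝ} (hu : IsCauchySolution T F g u)
    (hv : ContinuousOn v (strip d T)) (hvs : ∀ z ∈ openStrip d T, SupersolutionAt F v z)
    (hv0 : ∀ x, v (0, x) = g' x) (hgg : ∀ x, g x ≤ g' x) {z : ℝ × Rd d} (hz : z ∈ strip d T) :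
    u z ≤ v z := by
  obtain ⟨t, x⟩ := z
  have ht : 0 ≤ t ∧ t < T := hz.1
  have hss : Icc 0 ((t + T) / 2) ×ˢ Metric.closedBall x (β * t + 1) ⊆ strip d T :=
    prod_mono (fun y hy => ⟨hy.1, hy.2.trans_lt (by linarith)⟩) (subset_univ _)
  have hos : Ioo 0 ((t + T) / 2) ×ˢ Metric.ball x (β * t + 1) ⊆ openStrip d T :=
    prod_mono (fun y hy => ⟨hy.1, hy.2.trans (by linarith)⟩) (subset_univ _)
  exact cone_le (x₀ := x) (R := β * t + 1) hβ hF hFx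
    (hu.continuousOn.mono hss).upperSemicontinuousOn (hv.mono hss).neg.upperSemicontinuousOn
    (fun z hz => hu.sub.subsolutionAt (hos hz)) (fun z hz => hvs z (hos hz))
    (fun y _ => by rw [hu.initial, hv0]; exact hgg y) ⟨ht.1, by linarith⟩ (by simp)

theorem IsCauchySolution.isUniqueCauchySolution {T C : ℝ} (hβ : 0 ≤ β) (hF : CondH2 β F)
    (hFx : CondH3 C F) {g : Rd d → ℝ} {u : ℝ × Rd d → ℝ} (hu : IsCauchySolution T F g u) :
    IsUniqueCauchySolution T F g u :=
  ⟨hu, fun _ hv _ hz => le_antisymm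
    (hv.le hβ hF hFx hu.continuousOn (fun _ h => hu.super.supersolutionAt h) hu.initial
      (fun _ => le_rfl) hz)
    (hu.le hβ hF hFx hv.continuousOn (fun _ h => hv.super.supersolutionAt h) hv.initial
      (fun _ => le_rfl) hz)⟩

end Scheme

/-! ### Passage to the effective equation. -/

section Homogenization

variable {d : ℕ}

theorem SupersolutionAt.shift {F : Rd d → Rd d → ℝ} {v : ℝ × Rd d → ℝ} {z : ℝ × Rd d} {s : ℝ}
    (h : SupersolutionAt F v (z.1 - s, z.2)) :
    SupersolutionAt F (fun w => v (w.1 - s, w.2)) z := by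
  intro φ hφ hmin
  have hφ' : ContDiff ℝ 1 (fun w : ℝ × Rd d => φ (w.1 + s, w.2)) := by fun_prop
  have hto : Tendsto (fun w : ℝ × Rd d => ((w.1 + s, w.2) : ℝ × Rd d)) (𝓝 (z.1 - s, z.2)) (𝓝 z) :=
    Continuous.tendsto' (by fun_prop) _ _ (by simp)
  have h1 := h _ hφ' (by
    filter_upwards [hto.eventually hmin] with w hw
    simpa using hw)
  have h2 := deriv_comp_add_const (fun r => φ (r, z.2)) s (z.1 - s)
  rw [sub_add_cancel] at h2
  simp only [hjOperator, h2, sub_add_cancel] at h1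
  exact h1

/-- Locally uniform convergence of the solutions with linear initial data makes every family of
solutions asymptotically consistent with the effective equation. -/
theorem upperPropagation_of_linear {T β : ℝ} (hβ : 0 ≤ β) {F : ℝ → Rd d → Rd d → ℝ}
    (hF : ∀ ε, 0 < ε → CondH2 β (F ε)) (hFx : ∀ ε, 0 < ε → ∃ C, CondH3 C (F ε))
    {U : Rd d → ℝ → ℝ × Rd d → ℝ}
    (hU : ∀ θ ε, 0 < ε → IsCauchySolution T (F ε) (fun x => inner ℝ θ x) (U θ ε))
    {Hbar : Rd d → ℝ}
    (hconv : ∀ θ, ConvergesLocallyUniformly T (U θ) (fun z => inner ℝ θ z.2 - z.1 * Hbar θ))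
    {g : Rd d → ℝ} {u : ℝ → ℝ × Rd d → ℝ}
    (hu : ∀ ε, 0 < ε → IsCauchySolution T (F ε) g (u ε)) :
    UpperPropagation (𝓝[>] 0) T β 0 (fun _ p => Hbar p) u := by
  intro x₀ θ R T' η hT' hη
  have hQ : Icc 0 T' ×ˢ Metric.closedBall x₀ R ⊆ strip d T :=
    prod_mono (fun y hy => ⟨hy.1, hy.2.trans_lt hT'⟩) (subset_univ _)
  have hlim := Metric.tendstoUniformlyOn_iff.1 (hconv θ _
    (isCompact_Icc.prod (isCompact_closedBall x₀ R)) hQ) η hη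
  filter_upwards [hlim, self_mem_nhdsWithin] with ε hε hε0 s t a x hs hst htT hx hinit
  obtain ⟨C, hC⟩ := hFx ε hε0
  have hβt : 0 ≤ β * (t - s) := mul_nonneg hβ (sub_nonneg.2 hst)
  have hb : t < (T' + T) / 2 := by linarith
  -- The comparison function is the linear-data solution restarted at time `s`; the affine term of
  -- zero slope and speed only adds a constant. The final time lies strictly between `T'` and `T`,
  -- so that `t = T'` is allowed.
  have hcone := cone_le (x₀ := x₀) (R := R) (s := s) (b := (T' + T) / 2) (t₁ := t) (x₁ := x)
    (u := u ε) (v := fun w => U θ ε (w.1 - s, w.2) +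
      (a - inner ℝ θ x₀ + inner ℝ (0 : Rd d) w.2 + w.1 * 0)) hβ (hF ε hε0) hC
    ((hu ε hε0).continuousOn.mono
      (prod_mono (fun y hy => ⟨hs.trans hy.1, hy.2.trans_lt (by linarith)⟩)
        (subset_univ _))).upperSemicontinuousOn
    (by
      refine ContinuousOn.upperSemicontinuousOn (ContinuousOn.neg (ContinuousOn.add ?_ ?_))
      · refine (hU θ ε hε0).continuousOn.comp (f := fun w : ℝ × Rd d => (w.1 - s, w.2))
          (by fun_prop) fun w hw => ⟨⟨sub_nonneg.2 hw.1.1, ?_⟩, mem_univ _⟩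
        have := hw.1.2
        simp only
        linarith
      · exact (contDiff_affine 0 _ 0).continuous.continuousOn)
    (fun z hz => (hu ε hε0).sub.subsolutionAt
      ⟨⟨hs.trans_lt hz.1.1, hz.1.2.trans (by linarith)⟩, mem_univ _⟩)
    (fun z hz => SupersolutionAt.add_affine (hF ε hε0) (SupersolutionAt.shift
      ((hU θ ε hε0).super.supersolutionAt ⟨⟨sub_pos.2 hz.1.1, by
        have := hz.1.2
        simp only
        linarith⟩, mem_univ _⟩)) 0 _ (by simp))
    (fun y hy => by
      have := hinit y hy
      simp only [sub_self, (hU θ ε hε0).initial, inner_zero_left]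
      rw [inner_sub_right] at this
      linarith)
    ⟨hst, hb⟩ (by linarith)
  have hd := hε (t - s, x) ⟨⟨sub_nonneg.2 hst, by linarith⟩,
    mem_closedBall_iff_norm.2 (by linarith)⟩
  rw [Real.dist_eq] at hd
  have hd' := (abs_lt.1 hd).1
  simp only [inner_zero_left] at hcone hd'
  rw [inner_sub_right]
  linarith

/-- By `SupersolutionAt.add_affine`, changing the slope by `θ - θ'` at the cost of speed `β * ‖θ -
θ'‖` turns `v` into a supersolution with the data of `u`. -/
theorem IsCauchySolution.linear_le {T β C : ℝ} (hβ : 0 ≤ β) {F : Rd d → Rd d → ℝ}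
    (hF : CondH2 β F) (hFx : CondH3 C F) {θ θ' : Rd d} {u v : ℝ × Rd d → ℝ}
    (hu : IsCauchySolution T F (fun x => inner ℝ θ x) u)
    (hv : IsCauchySolution T F (fun x => inner ℝ θ' x) v) {z : ℝ × Rd d} (hz : z ∈ strip d T) :
    u z ≤ v z + (inner ℝ (θ - θ') z.2 + z.1 * (β * ‖θ - θ'‖)) := by
  have := hu.le (g' := fun x => inner ℝ θ x) hβ hF hFx
    (hv.continuousOn.add (contDiff_affine (θ - θ') 0 (β * ‖θ - θ'‖)).continuous.continuousOn)
    (fun z hz => (hv.super.supersolutionAt hz).add_affine hF _ _ le_rfl)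
    (fun x => by simp [hv.initial, inner_sub_left]) (fun _ => le_rfl) hz
  simpa using this

theorem IsCauchySolution.le_of_initial_nonpos {T β C : ℝ} (hβ : 0 ≤ β) {F : Rd d → Rd d → ℝ}
    (hF : CondH2 β F) (hFx : CondH3 C F) (hF0 : ∀ x, -F x 0 ≤ β) {g : Rd d → ℝ}
    (hg : ∀ x, g x ≤ 0) {u : ℝ × Rd d → ℝ} (hu : IsCauchySolution T F g u) {z : ℝ × Rd d}
    (hz : z ∈ strip d T) : u z ≤ z.1 * β := by
  have := hu.le (g' := fun _ => 0) hβ hF hFx (contDiff_affine 0 0 β).continuous.continuousOn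
    (fun z _ => supersolutionAt_affine (hF0 z.2)) (fun x => by simp) hg hz
  simpa using this

theorem ConvergesLocallyUniformly.tendsto {T : ℝ} {u : ℝ → ℝ × Rd d → ℝ} {v : ℝ × Rd d → ℝ}
    (h : ConvergesLocallyUniformly T u v) {z : ℝ × Rd d} (hz : z ∈ strip d T) :
    Tendsto (fun ε => u ε z) (𝓝[>] 0) (𝓝 (v z)) :=
  (h {z} isCompact_singleton (singleton_subset_iff.2 hz)).tendsto_at (mem_singleton z)

theorem ConvergesLocallyUniformly.neg {T : ℝ} {u : ℝ → ℝ × Rd d → ℝ} {v : ℝ × Rd d → ℝ}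
    (h : ConvergesLocallyUniformly T u v) :
    ConvergesLocallyUniformly T (fun ε z => -u ε z) (fun z => -v z) := by
  intro Q hQ hQs
  have := h Q hQ hQs
  rw [Metric.tendstoUniformlyOn_iff] at this ⊢
  simpa only [dist_neg_neg] using this

/-- Convergence for a dense set of slopes implies convergence for all slopes. -/
theorem convergesLocallyUniformly_of_dense {T β : ℝ} (hβ : 0 ≤ β) {F : ℝ → Rd d → Rd d → ℝ}
    (hF : ∀ ε, 0 < ε → CondH2 β (F ε)) (hFx : ∀ ε, 0 < ε → ∃ C, CondH3 C (F ε))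
    {U : Rd d → ℝ → ℝ × Rd d → ℝ}
    (hU : ∀ θ ε, 0 < ε → IsCauchySolution T (F ε) (fun x => inner ℝ θ x) (U θ ε))
    {Hbar : Rd d → ℝ} (hH : CondH2 β (fun _ : Rd d => Hbar)) {D : Set (Rd d)} (hD : Dense D)
    (hconv : ∀ θ ∈ D,
      ConvergesLocallyUniformly T (U θ) (fun z => inner ℝ θ z.2 - z.1 * Hbar θ)) (θ : Rd d) :
    ConvergesLocallyUniformly T (U θ) (fun z => inner ℝ θ z.2 - z.1 * Hbar θ) := by
  intro Q hQ hQs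
  rw [Metric.tendstoUniformlyOn_iff]
  intro δ hδ
  have hcont : Continuous (fun z : ℝ × Rd d => ‖z.2‖ + z.1 * β) := by fun_prop
  obtain ⟨B, hB⟩ := hQ.bddAbove_image hcont.continuousOn
  have hsmall : ∀ᶠ θ' in 𝓝 θ, ‖θ - θ'‖ * (|B| + 1) < δ / 4 :=
    ContinuousAt.eventually_lt (by fun_prop) continuousAt_const (by simpa using hδ)
  obtain ⟨θ', hθ', hθD⟩ := mem_closure_iff_nhds.1 (hD θ) _ hsmall
  -- This error occurs twice, between the solutions and between the limits; convergence for `θ'`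
  -- adds a third `δ / 4`.
  have hbd : ∀ z ∈ Q, ‖θ - θ'‖ * (‖z.2‖ + z.1 * β) < δ / 4 := fun z hz => by
    have h1 := hB (mem_image_of_mem _ hz)
    exact (mul_le_mul_of_nonneg_left (h1.trans (by linarith [le_abs_self B]))
      (norm_nonneg _)).trans_lt hθ'
  filter_upwards [Metric.tendstoUniformlyOn_iff.1 (hconv θ' hθD Q hQ hQs) (δ / 4) (by positivity),
    self_mem_nhdsWithin] with ε hε hε0 z hz
  obtain ⟨C, hC⟩ := hFx ε hε0
  have h1 := (hU θ ε hε0).linear_le hβ (hF ε hε0) hC (hU θ' ε hε0) (hQs hz)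
  have h2 := (hU θ' ε hε0).linear_le hβ (hF ε hε0) hC (hU θ ε hε0) (hQs hz)
  have h3 := hε z hz
  have h4 := hbd z hz
  have h5 := abs_le.1 (abs_real_inner_le_norm (θ - θ') z.2)
  have h6 := abs_le.1 (hH 0 θ θ')
  have ht : 0 ≤ z.1 := (hQs hz).1.1
  have h7 := mul_le_mul_of_nonneg_left h6.1 ht
  have h8 := mul_le_mul_of_nonneg_left h6.2 ht
  rw [norm_sub_rev θ' θ] at h2
  rw [Real.dist_eq] at h3 ⊢
  rw [abs_lt] at h3 ⊢
  simp only [inner_sub_left] at h1 h2 h5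
  constructor <;> linarith [h3.1, h3.2, h5.1, h5.2]

theorem CondH2.rescale {β : ℝ} {F : Rd d → Rd d → ℝ} (h : CondH2 β F) (ε : ℝ) :
    CondH2 β (rescale F ε) :=
  fun x p q => h (ε⁻¹ • x) p q

theorem CondH3.rescale {β ε : ℝ} {F : Rd d → Rd d → ℝ} (h : CondH3 β F) (hε : 0 < ε) :
    CondH3 (β * ε⁻¹) (rescale F ε) := by
  intro x y p
  have := h (ε⁻¹ • x) (ε⁻¹ • y) p
  rwa [← smul_sub, norm_smul, Real.norm_of_nonneg (inv_nonneg.2 hε.le), ← mul_assoc] at this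

/-- Homogenization for a single Hamiltonian, from the convergence of the solutions with linear
initial data. -/
theorem homogenization_of_linear {T β : ℝ} (hT : 0 < T) (hβ : 0 < β) {F : Rd d → Rd d → ℝ}
    (hF : CondH2 β F) (hFx : CondH3 β F) {U : Rd d → ℝ → ℝ × Rd d → ℝ}
    (hU : ∀ θ ε, 0 < ε → IsCauchySolution T (rescale F ε) (fun x => inner ℝ θ x) (U θ ε))
    {Hbar : Rd d → ℝ} (hH : CondH2 β (fun _ : Rd d => Hbar))
    (hconv : ∀ θ, ConvergesLocallyUniformly T (U θ) (fun z => inner ℝ θ z.2 - z.1 * Hbar θ))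
    {g : Rd d → ℝ} (hg : Continuous g) :
    ∃ (u : ℝ → ℝ × Rd d → ℝ) (ubar : ℝ × Rd d → ℝ),
      (∀ ε, 0 < ε → IsUniqueCauchySolution T (rescale F ε) g (u ε)) ∧
      IsUniqueCauchySolution T (fun _ p => Hbar p) g ubar ∧
      ConvergesLocallyUniformly T u ubar := by
  have hex : ∀ ε, ∃ v, 0 < ε → IsCauchySolution T (rescale F ε) g v := by
    intro ε
    by_cases hε : 0 < ε
    · obtain ⟨v, hv⟩ := exists_isCauchySolution hT hβ (by positivity) (hF.rescale ε)
        (hFx.rescale hε) hg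
      exact ⟨v, fun _ => hv⟩
    · exact ⟨0, fun h => absurd h hε⟩
  choose u hu using hex
  have hH3 : CondH3 0 (fun _ p => Hbar p : Rd d → Rd d → ℝ) := fun x y p => by simp
  have h1 : UpperPropagation (𝓝[>] 0) T β 0 (fun _ p => Hbar p) u :=
    upperPropagation_of_linear hβ.le (fun ε _ => hF.rescale ε)
      (fun ε hε => ⟨_, hFx.rescale hε⟩) hU hconv hu
  have h2 : UpperPropagation (𝓝[>] 0) T β 0 (dualHamiltonian fun _ p => Hbar p)
      (fun ε z => -u ε z) := by
    -- For the dual equation the solution with slope `θ` is minus the original one with slope `-θ`.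
    refine upperPropagation_of_linear (F := fun ε => dualHamiltonian (rescale F ε))
      (U := fun θ ε z => -U (-θ) ε z) (Hbar := fun p => -Hbar (-p)) hβ.le
      (fun ε _ => (hF.rescale ε).dual) (fun ε hε => ⟨_, (hFx.rescale hε).dual⟩) ?_ ?_
      (fun ε hε => (hu ε hε).neg)
    · intro θ ε hε
      simpa only [inner_neg_left, neg_neg] using (hU (-θ) ε hε).neg
    · intro θ
      convert (hconv (-θ)).neg using 2 with z
      rw [inner_neg_left]
      ring
  have h0 : ∀ᶠ ε in 𝓝[>] (0 : ℝ), ∀ x, u ε (0, x) = g x :=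
    eventually_mem_nhdsWithin.mono fun ε hε => (hu ε hε).initial
  obtain ⟨ubar, hubar, hlim⟩ :=
    exists_cauchySolution_of_upperPropagation hT hβ.le hH hH3 hβ.le hg h0 h1 h2
  exact ⟨u, ubar, fun ε hε => (hu ε hε).isUniqueCauchySolution hβ.le (hF.rescale ε)
    (hFx.rescale hε), hubar.isUniqueCauchySolution hβ.le hH hH3, hlim⟩

/-- Let `ε → 0` in `linear_le` at `(T / 2, 0)`, where the linear terms vanish, and divide by `T /
2`. -/
theorem effective_sub_le {T β : ℝ} (hT : 0 < T) (hβ : 0 ≤ β) {F : Rd d → Rd d → ℝ}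
    (hF : CondH2 β F) (hFx : CondH3 β F) {U : Rd d → ℝ → ℝ × Rd d → ℝ}
    (hU : ∀ θ ε, 0 < ε → IsCauchySolution T (rescale F ε) (fun x => inner ℝ θ x) (U θ ε))
    {Hbar : Rd d → ℝ} {p q : Rd d}
    (hp : ConvergesLocallyUniformly T (U p) (fun z => inner ℝ p z.2 - z.1 * Hbar p))
    (hq : ConvergesLocallyUniformly T (U q) (fun z => inner ℝ q z.2 - z.1 * Hbar q)) :
    Hbar p - Hbar q ≤ β * ‖p - q‖ := by
  have hz : ((T / 2, 0) : ℝ × Rd d) ∈ strip d T :=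
    ⟨⟨by positivity, by simp only; linarith⟩, mem_univ _⟩
  have h := le_of_tendsto_of_tendsto (hq.tendsto hz) ((hp.tendsto hz).add_const
      (inner ℝ (q - p) (0 : Rd d) + T / 2 * (β * ‖q - p‖)))
    (eventually_mem_nhdsWithin.mono fun ε hε => (hU q ε hε).linear_le hβ (hF.rescale ε)
      (hFx.rescale hε) (hU p ε hε) hz)
  simp only [inner_zero_right] at h
  rw [norm_sub_rev]
  nlinarith

/-- For zero data, `t * β` is a supersolution of both the equation and its dual because `|F x 0| ≤
β`. -/
theorem abs_effective_zero_le {T β : ℝ} (hT : 0 < T) (hβ : 0 ≤ β) {F : Rd d → Rd d → ℝ}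
    (hF1 : CondH1 β F) (hF : CondH2 β F) (hFx : CondH3 β F) {U : ℝ → ℝ × Rd d → ℝ}
    (hU : ∀ ε, 0 < ε → IsCauchySolution T (rescale F ε) (fun x => inner ℝ 0 x) (U ε)) {h₀ : ℝ}
    (hconv : ConvergesLocallyUniformly T U (fun z => inner ℝ 0 z.2 - z.1 * h₀)) : |h₀| ≤ β := by
  have hz : ((T / 2, 0) : ℝ × Rd d) ∈ strip d T :=
    ⟨⟨by positivity, by simp only; linarith⟩, mem_univ _⟩
  have hF0 : ∀ x, |F x 0| ≤ β := fun x => by simpa using hF1 x 0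
  have h1 := le_of_tendsto (hconv.tendsto hz)
    (eventually_mem_nhdsWithin.mono fun ε hε => (hU ε hε).le_of_initial_nonpos hβ (hF.rescale ε)
      (hFx.rescale hε) (fun x => neg_le.1 (abs_le.1 (hF0 _)).1) (fun x => by simp) hz)
  have h2 := le_of_tendsto (hconv.neg.tendsto hz)
    (eventually_mem_nhdsWithin.mono fun ε hε => (hU ε hε).neg.le_of_initial_nonpos hβ
      (hF.rescale ε).dual (hFx.rescale hε).dual
      (fun x => by simpa [dualHamiltonian, rescale] using (abs_le.1 (hF0 (ε⁻¹ • x))).2)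
      (fun x => by simp) hz)
  simp only [inner_zero_left] at h1 h2
  rw [abs_le]
  constructor <;> nlinarith

end Homogenization

theorem mainTheorem7 {d : ℕ} {Ω : Type*} [MeasurableSpace Ω] (P : Measure Ω)
    [IsProbabilityMeasure P] (T : ℝ) (hT : 0 < T) (β : ℝ) (hβ : 0 < β)
    (H : Rd d → Rd d → Ω → ℝ)
    (hH1 : ∀ ω, CondH1 β (fun x p => H x p ω))
    (hH2 : ∀ ω, CondH2 β (fun x p => H x p ω))
    (hH3 : ∀ ω, CondH3 β (fun x p => H x p ω))
    (uLin : Rd d → ℝ → Ω → ℝ × Rd d → ℝ)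
    (huLin : ∀ θ ε, 0 < ε → ∀ ω,
      IsCauchySolution T (rescale (fun x p => H x p ω) ε) (fun x => inner ℝ θ x) (uLin θ ε ω))
    (Hbar : Rd d → ℝ)
    (hconv : ∀ θ, ∀ᵐ ω ∂P, ConvergesLocallyUniformly T (fun ε => uLin θ ε ω)
      (fun z => inner ℝ θ z.2 - z.1 * Hbar θ)) :
    CondH1 β (fun _ p => Hbar p) ∧ CondH2 β (fun _ p => Hbar p) ∧
    ∀ᵐ ω ∂P, ∀ g : Rd d → ℝ, UniformContinuous g →
      ∃ (u : ℝ → ℝ × Rd d → ℝ) (ubar : ℝ × Rd d → ℝ),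
        (∀ ε, 0 < ε → IsUniqueCauchySolution T (rescale (fun x p => H x p ω) ε) g (u ε)) ∧
        IsUniqueCauchySolution T (fun _ p => Hbar p) g ubar ∧
        ConvergesLocallyUniformly T u ubar := by
  have hH2bar : CondH2 β (fun _ p => Hbar p : Rd d → Rd d → ℝ) := by
    intro _ p q
    -- `Hbar` is deterministic, so a single `ω` good for both slopes suffices.
    obtain ⟨ω, hp, hq⟩ := ((hconv p).and (hconv q)).exists
    have hU := fun θ ε hε => huLin θ ε hε ω
    rw [abs_le]
    have h1 := effective_sub_le hT hβ.le (hH2 ω) (hH3 ω) hU hp hq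
    have h2 := effective_sub_le hT hβ.le (hH2 ω) (hH3 ω) hU hq hp
    rw [norm_sub_rev] at h2
    constructor <;> linarith
  have hH1bar : CondH1 β (fun _ p => Hbar p : Rd d → Rd d → ℝ) := by
    intro x p
    obtain ⟨ω, h0⟩ := (hconv 0).exists
    have h1 := abs_le.1 (abs_effective_zero_le hT hβ.le (hH1 ω) (hH2 ω) (hH3 ω)
      (fun ε hε => huLin 0 ε hε ω) h0)
    have h2 := abs_le.1 (hH2bar x p 0)
    rw [sub_zero] at h2
    rw [abs_le]
    constructor <;> linarith [h1.1, h1.2, h2.1, h2.2]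
  refine ⟨hH1bar, hH2bar, ?_⟩
  -- Only countably many null sets are discarded, independently of `g`.
  obtain ⟨D, hDc, hD⟩ := TopologicalSpace.exists_countable_dense (Rd d)
  filter_upwards [(ae_ball_iff hDc).2 fun θ _ => hconv θ] with ω hω g hg
  have hU := fun θ ε hε => huLin θ ε hε ω
  exact homogenization_of_linear hT hβ (hH2 ω) (hH3 ω) hU hH2bar
    (convergesLocallyUniformly_of_dense hβ.le (fun ε _ => (hH2 ω).rescale ε)
      (fun ε hε => ⟨_, (hH3 ω).rescale hε⟩) hU hH2bar hD hω) hg.continuous
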